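/- Notation. Let $m,n\ge 1$ be integers with $m$ even. A tensor $\mathcal A$ of order $m$ and dimension $n$ is an array of real entries $a_{i_1\cdots i_m}$, $i_1,\dots,i_m\in[n]=\{1,\dots,n\}$; more generally the indices may range over a finite set $\Gamma$, and the dimension is then $|\Gamma|$. The tensor is symmetric if its entries are invariant under all permutations of the indices; entries $a_{i\cdots i}$ are diagonal, all others off-diagonal. Put $\mathcal A x^m=\sum_{i_1,\dots,i_m}a_{i_1\cdots i_m}x_{i_1}\cdots x_{i_m}$ and $\|x\|_m^m=\sum_i x_i^m$. A real number $\lambda$ is an H-eigenvalue of $\mathcal A$ if there is a real vector $x\ne 0$ with $\sum_{i_2,\dots,i_m}a_{i i_2\cdots i_m}x_{i_2}\cdots x_{i_m}=\lambda x_i^{m-1}$ for all $i\in[n]$; $\lambda_{\max}(\mathcal A)$ denotes the largest H-eigenvalue. For a finite set of variables $y$, let $\Sigma_m^2[y]$ be the set of sums of squares of real polynomials in $y$ that have degree at most $m$. The tensor $\mathcal A$ is a W-tensor if there are an integer $1\le s\le n$, pairwise different sets $\Gamma_1,\dots,\Gamma_s\subseteq[n]$ with $\bigcup_l\Gamma_l=[n]$,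 and tensors $\mathcal A_{\Gamma_l}$ of order $m$ with indices in $\Gamma_l$ (called subtensors) such that (i) $s=1$, or $\left|\left(\bigcup_{l<p}\Gamma_l\right)\cap\Gamma_p\right|\le 1$ for all $2\le p\le s$; (ii) $\mathcal A x^m=\sum_{l=1}^s\mathcal A_{\Gamma_l}x_{\Gamma_l}^m$ for all $x\in\mathbb R^n$, where $x_{\Gamma_l}=(x_i)_{i\in\Gamma_l}$; (iii) for each $l$, either there is a non-constant tuple $(j_1,\dots,j_m)\in\Gamma_l^m$ such that all off-diagonal entries of $\mathcal A_{\Gamma_l}$ at tuples that are not permutations of $(j_1,\dots,j_m)$ vanish, or all off-diagonal entries of $\mathcal A_{\Gamma_l}$ are nonnegative. Theorem. Let $\mathcal A$ be a symmetric W-tensor of even order $m$ and dimension $n$. Then $\lambda_{\max}(\mathcal A)$ exists, and the following hold, where each minimum is attained. (a) $$\lambda_{\max}(\mathcal A)=\min_{t,\mu\in\mathbb R}\{t : t-\mathcal A x^m+\mu(\|x\|_m^m-1)\in\Sigma_m^2[x]\}.$$ (b) For all sets $\Gamma_l$ and subtensors $\mathcal A_{\Gamma_l}$, $l\in[s]$,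 as in the definition of a W-tensor, $$\lambda_{\max}(\mathcal A)=\min_{t,\rho_i^l\in\mathbb R}\Big\{t : -\mathcal A_{\Gamma_l}x_{\Gamma_l}^m+\sum_{i\in\Gamma_l}\rho_i^l x_i^m\in\Sigma_m^2[x_{\Gamma_l}]\ (l\in[s]),\ \sum_{l:\,i\in\Gamma_l}\rho_i^l\le t\ (i\in[n])\Big\}.$$ (c) Consequently $\lambda_{\max}(\mathcal A)$ is the optimal value of a single explicit semidefinite program: minimize $t$ over $t,\mu\in\mathbb R$ and positive semidefinite real symmetric matrices $Q=(Q_{\alpha\beta})$, indexed by the exponents $\alpha,\beta\in\mathbb Z_{\ge 0}^n$ with $|\alpha|,|\beta|\le m/2$, subject to the linear equations which say that, for every exponent $\gamma$ with $|\gamma|\le m$, the coefficient of $x^\gamma$ in $t-\mathcal A x^m+\mu(\|x\|_m^m-1)$ equals $\sum_{\alpha+\beta=\gamma}Q_{\alpha\beta}$. -/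

import Mathlib

open MvPolynomial

namespace WTensor

/-- A real tensor of order `m` whose indices range over `ι` (its dimension is `|ι|`). -/
abbrev Tensor (m : ℕ) (ι : Type) : Type := (Fin m → ι) → ℝ

section Tensors

variable {m : ℕ} {ι : Type}

/-- The entries are invariant under every permutation of the indices. -/
def IsSymmetric (A : Tensor m ι) : Prop :=
  ∀ (σ : Equiv.Perm (Fin m)) (i : Fin m → ι), A (i ∘ σ) = A i

/-- The index tuple `(k, …, k)` for some `k`. -/
def IsDiagonal (i : Fin m → ι) : Prop := ∃ k : ι, ∀ a, i a = k

variable [Fintype ι]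

/-- `A x^m`, the value of the form of `A` at `x`. -/
def form (A : Tensor m ι) (x : ι → ℝ) : ℝ :=
  ∑ i : Fin m → ι, A i * ∏ a, x (i a)

/-- `A x^m`, as a polynomial in the variables `x_i`, `i ∈ ι`. -/
noncomputable def poly (A : Tensor m ι) : MvPolynomial ι ℝ :=
  ∑ i : Fin m → ι, C (A i) * ∏ a, X (i a)

open scoped Classical in
/-- The `i`-th component of the vector `A x^(m-1)`: the sum of
`a_{i i₂ … i_m} x_{i₂} ⋯ x_{i_m}` over all tuples whose first index is `i`. -/
noncomputable def contract (A : Tensor m ι) (x : ι → ℝ) (i : ι) : ℝ :=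
  ∑ j : Fin m → ι with (∀ a : Fin m, a.val = 0 → j a = i),
    A j * ∏ a : Fin m with a.val ≠ 0, x (j a)

/-- `lam` is an H-eigenvalue of `A`: it is real, with a real eigenvector `x ≠ 0`,
`A x^(m-1) = lam x^[m-1]`. -/
def IsHEigenvalue (A : Tensor m ι) (lam : ℝ) : Prop :=
  ∃ x : ι → ℝ, x ≠ 0 ∧ ∀ i, contract A x i = lam * x i ^ (m - 1)

/-- The maximum H-eigenvalue. -/
noncomputable def lambdaMax (A : Tensor m ι) : ℝ := sSup {lam | IsHEigenvalue A lam}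

end Tensors

/-- The sums of squares of real polynomials in the variables `x_i`, `i ∈ ι`, that have degree at
most `m`. -/
def SOS (ι : Type) (m : ℕ) : Set (MvPolynomial ι ℝ) :=
  {p | p.totalDegree ≤ m ∧ IsSumSq p}

/-- The index sets `Γ l` and the tensors `B l` of order `m` and dimension `|Γ l|` exhibit `A` as a
W-tensor; the `B l` are then called subtensors of `A`. -/
structure IsWDecomposition {m n : ℕ} (A : Tensor m (Fin n)) {s : ℕ}
    (Γ : Fin s → Finset (Fin n)) (B : (l : Fin s) → Tensor m (Γ l)) : Prop where
  one_le : 1 ≤ s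
  le_dim : s ≤ n
  cover : ∀ i, ∃ l, i ∈ Γ l
  distinct : ∀ l₁ l₂, l₁ ≠ l₂ → Γ l₁ ≠ Γ l₂
  inter : s = 1 ∨ ∀ p : Fin s, 0 < p.val →
    (((Finset.univ.filter (fun l => l < p)).biUnion Γ) ∩ Γ p).card ≤ 1
  form_eq : ∀ x : Fin n → ℝ, form A x = ∑ l, form (B l) (fun i => x i)
  sign : ∀ l,
    (∃ j : Fin m → Γ l, ¬ IsDiagonal j ∧
      ∀ i : Fin m → Γ l, ¬ IsDiagonal i →
        (¬ ∃ σ : Equiv.Perm (Fin m), i = j ∘ σ) → B l i = 0) ∨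
    (∀ i : Fin m → Γ l, ¬ IsDiagonal i → 0 ≤ B l i)

/-- `A` is a W-tensor. -/
def IsWTensor {m n : ℕ} (A : Tensor m (Fin n)) : Prop :=
  ∃ (s : ℕ) (Γ : Fin s → Finset (Fin n)) (B : (l : Fin s) → Tensor m (Γ l)),
    IsWDecomposition A Γ B

/-- The data of a semidefinite program with free real variables `y_v`, `v ∈ V`, one symmetric
matrix variable `Q` with rows and columns indexed by `R`, and linear equations indexed by `K`
(all three index sets finite):
minimize `∑ v, cost v * y v` subject to `Q ⪰ 0` and
`⟨mat k, Q⟩ + ∑ v, lin k v * y v = rhs k` for every `k`. -/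
structure SDP (V R K : Type) [Fintype V] [Fintype R] [Fintype K] where
  cost : V → ℝ
  mat : K → Matrix R R ℝ
  lin : K → V → ℝ
  rhs : K → ℝ

namespace SDP

variable {V R K : Type} [Fintype V] [Fintype R] [Fintype K]

/-- `(y, Q)` satisfies the constraints. -/
def Feasible (P : SDP V R K) (y : V → ℝ) (Q : Matrix R R ℝ) : Prop :=
  Q.PosSemidef ∧
    ∀ k, (∑ r, ∑ c, P.mat k r c * Q r c) + ∑ v, P.lin k v * y v = P.rhs k

/-- `t` is the optimal value, and it is attained. -/
def IsOptimalValue (P : SDP V R K) (t : ℝ) : Prop :=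
  IsLeast {u | ∃ y Q, P.Feasible y Q ∧ u = ∑ v, P.cost v * y v} t

end SDP

/-- The exponents of the monomials of degree at most `d` in `n` variables. -/
def exponents (n d : ℕ) : Finset (Fin n →₀ ℕ) :=
  (Finset.range (d + 1)).biUnion (fun k => Finset.finsuppAntidiag Finset.univ k)

theorem mem_exponents {n d : ℕ} {α : Fin n →₀ ℕ} : α ∈ exponents n d ↔ ∑ i, α i ≤ d := by
  simp [exponents]

/-- The semidefinite program with variables `y 0 = t`, `y 1 = μ` and a matrix `Q` indexed by the
monomials of degree at most `m / 2`, which minimizes `t` subject to `Q ⪰ 0` and to the equality of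
the coefficients of `x^γ`, for all `γ` of degree at most `m`, in
`∑ α β, Q α β x^(α+β)` and in `t - A x^m + μ (∑ i, x_i^m - 1)`. -/
noncomputable def maxHEigSDP {m n : ℕ} (A : Tensor m (Fin n)) :
    SDP (Fin 2) (exponents n (m / 2)) (exponents n m) where
  cost := ![1, 0]
  mat := fun γ => Matrix.of fun α β => if (α : Fin n →₀ ℕ) + β = γ then 1 else 0
  lin := fun γ => ![-coeff γ.1 1, -coeff γ.1 (∑ i, X i ^ m - 1)]
  rhs := fun γ => -coeff γ.1 (poly A)

end WTensor

open WTensor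

/-! Since `m` is even, the form attains a maximum `M` on the compact sphere `∑ x_i^m = 1`. By
homogeneity `M ∑ x_i^m - A x^m` is nonnegative and vanishes at a maximizer; its partial derivatives
there are zero, which is the eigenvalue equation. Pairing any eigenvalue equation with its
eigenvector shows that no H-eigenvalue exceeds `M`. Evaluating a certificate at the maximizer `x₀`
shows that no feasible `t` is below `M`. What remains is to certify `M` by sums of squares, and this
is where the W-structure enters.

Gluing (`exists_rebalancing`): the blocks can be removed one at a time, each sharing at most one
variable with the earlier ones. A nonnegative sum of two even-degree forms sharing only `x_k`
becomes a sum of nonnegative forms after moving a suitable multiple of `x_k^m` from one to the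
other. So a diagonal can be distributed over the blocks with every block form nonnegative.

Blocks (`isSumSq_diagonal_sub_poly`): each block is a diagonal plus either multiples of a single
monomial or a tail of favourable sign. With one monomial, Hurwitz's form of the AM-GM inequality,
rescaled at its equality point, gives the squares. With many, Hahn-Banach separation splits the
diagonal among the monomials (`mem_splitDiagonals`), reducing to one.

For the semidefinite program, leading terms of squares cannot cancel, so each square in a
certificate of degree at most `m` comes from a polynomial of degree at most `m / 2` and yields a
rank-one Gram matrix. -/

namespace WTensor

/-! ### Sums of squares and Hurwitz's AM-GM certificate -/

section SumSq

variable {R : Type*} [CommRing R]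

theorem isSumSq_sq (a : R) : IsSumSq (a ^ 2) := by
  rw [sq]; exact IsSumSq.mul_self a

theorem isSumSq_even_pow {m : ℕ} (hm : Even m) (a : R) : IsSumSq (a ^ m) :=
  (hm.isSquare_pow a).isSumSq

theorem isSumSq_map {S : Type*} [CommRing S] (f : R →+* S) {p : R} (hp : IsSumSq p) :
    IsSumSq (f p) := by
  induction hp with
  | zero => simp
  | sq_add a _ ih => rw [map_add, map_mul]; exact .sq_add _ ih

/-- Factoring out `x^2 - y^2` leaves its square times a geometric sum, each of whose terms is a
square. -/
theorem isSumSq_pow_sub_pow_mul_sub (x y : R) (k : ℕ) :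
    IsSumSq (((x ^ 2) ^ k - (y ^ 2) ^ k) * (x ^ 2 - y ^ 2)) := by
  rw [← (Commute.all (x ^ 2) (y ^ 2)).geom_sum₂_mul k, mul_assoc, ← sq]
  refine (IsSumSq.sum fun i _ => ?_).mul (isSumSq_sq _)
  rw [← pow_mul, ← pow_mul, mul_comm 2, mul_comm 2, pow_mul, pow_mul, ← mul_pow]
  exact isSumSq_sq _

variable [Algebra ℝ R]

theorem isSumSq_algebraMap {c : ℝ} (hc : 0 ≤ c) : IsSumSq (algebraMap ℝ R c) := by
  have : c = Real.sqrt c ^ 2 := (Real.sq_sqrt hc).symm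
  rw [this, map_pow]
  exact isSumSq_sq _

theorem isSumSq_smul {c : ℝ} (hc : 0 ≤ c) {p : R} (hp : IsSumSq p) : IsSumSq (c • p) := by
  rw [Algebra.smul_def]
  exact (isSumSq_algebraMap hc).mul hp

/-- The arithmetic-geometric mean inequality for squares, certified by sums of squares. -/
theorem isSumSq_sum_pow_card_sub_card_mul_prod {κ : Type*} [DecidableEq κ] (y : κ → R) (k : ℕ)
    (S : Finset κ) (hS : S.card = k) :
    IsSumSq (∑ a ∈ S, (y a ^ 2) ^ k - (k : R) * ∏ a ∈ S, y a ^ 2) := by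
  induction k generalizing S with
  | zero => simp_all
  | succ k ih =>
    rcases Nat.eq_zero_or_pos k with rfl | hk
    · obtain ⟨a, rfl⟩ := Finset.card_eq_one.1 hS
      simp
    -- The induction hypothesis with each `j` left out, weighted by `y j ^ 2`, plus the
    -- Chebyshev-type double sum `h2`, adds up to `k` times the claim. Dividing by `k` is why `k =
    -- 0` was treated apart.
    have h1 : IsSumSq (∑ j ∈ S, y j ^ 2 *
        (∑ a ∈ S.erase j, (y a ^ 2) ^ k - (k : R) * ∏ a ∈ S.erase j, y a ^ 2)) := by
      refine IsSumSq.sum fun j hj => (isSumSq_sq _).mul (ih _ ?_)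
      rw [Finset.card_erase_of_mem hj, hS, Nat.add_sub_cancel]
    have h2 : IsSumSq ((1 / 2 : ℝ) • ∑ j ∈ S, ∑ a ∈ S,
        ((y a ^ 2) ^ k - (y j ^ 2) ^ k) * (y a ^ 2 - y j ^ 2)) :=
      isSumSq_smul (by norm_num) <| IsSumSq.sum fun j _ => IsSumSq.sum fun a _ =>
        isSumSq_pow_sub_pow_mul_sub _ _ _
    have e1 : ∑ j ∈ S, y j ^ 2 *
        (∑ a ∈ S.erase j, (y a ^ 2) ^ k - (k : R) * ∏ a ∈ S.erase j, y a ^ 2)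
        = (∑ j ∈ S, y j ^ 2) * (∑ a ∈ S, (y a ^ 2) ^ k) - ∑ j ∈ S, (y j ^ 2) ^ (k + 1)
          - (k : R) * ((k + 1 : ℕ) : R) * ∏ a ∈ S, y a ^ 2 := by
      have : ∀ j ∈ S, y j ^ 2 *
          (∑ a ∈ S.erase j, (y a ^ 2) ^ k - (k : R) * ∏ a ∈ S.erase j, y a ^ 2)
          = y j ^ 2 * (∑ a ∈ S, (y a ^ 2) ^ k) - (y j ^ 2) ^ (k + 1)
            - (k : R) * ∏ a ∈ S, y a ^ 2 := by
        intro j hj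
        rw [← Finset.mul_prod_erase S _ hj, ← Finset.add_sum_erase S _ hj]
        ring
      rw [Finset.sum_congr rfl this, Finset.sum_sub_distrib, Finset.sum_sub_distrib,
        Finset.sum_const, hS, ← Finset.sum_mul, nsmul_eq_mul]
      ring
    have e2 : ∑ j ∈ S, ∑ a ∈ S, ((y a ^ 2) ^ k - (y j ^ 2) ^ k) * (y a ^ 2 - y j ^ 2)
        = (2 : ℝ) • ((((k + 1 : ℕ) : R)) * ∑ j ∈ S, (y j ^ 2) ^ (k + 1)
          - (∑ j ∈ S, y j ^ 2) * (∑ a ∈ S, (y a ^ 2) ^ k)) := by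
      have : ∀ j a, ((y a ^ 2) ^ k - (y j ^ 2) ^ k) * (y a ^ 2 - y j ^ 2)
          = (y a ^ 2) ^ (k + 1) + (y j ^ 2) ^ (k + 1) - (y j ^ 2 * (y a ^ 2) ^ k)
            - ((y j ^ 2) ^ k * y a ^ 2) := fun j a => by ring
      simp only [this, Finset.sum_sub_distrib, Finset.sum_add_distrib, Finset.sum_const, hS,
        ← Finset.mul_sum, ← Finset.sum_mul, nsmul_eq_mul]
      rw [two_smul]
      ring
    rw [e2, smul_smul] at h2
    norm_num at h2
    rw [e1] at h1
    have h3 := isSumSq_smul (R := R) (c := (k : ℝ)⁻¹) (by positivity) (h1.add h2)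
    have hk' : (k : ℝ) ≠ 0 := by positivity
    convert h3 using 1
    have : ∑ a ∈ S, (y a ^ 2) ^ (k + 1) - ((k + 1 : ℕ) : R) * ∏ a ∈ S, y a ^ 2
        = (k : ℝ)⁻¹ • ((k : R) * (∑ a ∈ S, (y a ^ 2) ^ (k + 1)
          - ((k + 1 : ℕ) : R) * ∏ a ∈ S, y a ^ 2)) := by
      rw [← nsmul_eq_mul k, ← Nat.cast_smul_eq_nsmul ℝ, smul_smul, inv_mul_cancel₀ hk', one_smul]
    rw [this]
    congr 1
    push_cast
    ring

/-- Hurwitz: for even `m` the form `∑ a, y a ^ m - m * ∏ a, y a` is a sum of squares. -/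
theorem isSumSq_sum_pow_sub_mul_prod {m : ℕ} (hm : Even m) (y : Fin m → R) :
    IsSumSq (∑ a, y a ^ m - (m : R) * ∏ a, y a) := by
  obtain ⟨k, rfl⟩ := hm
  have h1 := isSumSq_sum_pow_card_sub_card_mul_prod (fun a : Fin k => y (Fin.castAdd k a)) k
    Finset.univ (by simp)
  have h2 := isSumSq_sum_pow_card_sub_card_mul_prod (fun a : Fin k => y (Fin.natAdd k a)) k
    Finset.univ (by simp)
  -- Each half of the variables controls its product of squares `P^2`, `Q^2`; adding `k (P - Q)^2`
  -- turns `-k P^2 - k Q^2` into `-2k P Q`.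
  have h3 := (IsSumSq.natCast (R := R) k).mul
    (isSumSq_sq (∏ a, y (Fin.castAdd k a) - ∏ a, y (Fin.natAdd k a)))
  refine Eq.subst (motive := IsSumSq) ?_ ((h1.add h2).add h3)
  rw [Fin.prod_univ_add, Fin.sum_univ_add]
  simp only [← pow_mul, Finset.prod_pow, ← two_mul]
  push_cast
  ring

end SumSq

/-- The weighted arithmetic-geometric mean inequality in the form used for tensors. -/
theorem mul_prod_le_sum_pow {m : ℕ} (hm : Even m) (y : Fin m → ℝ) :
    m * ∏ a, y a ≤ ∑ a, y a ^ m :=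
  sub_nonneg.1 (isSumSq_sum_pow_sub_mul_prod hm y).nonneg

/-! ### Diagonal-minus-tail forms: splitting the diagonal -/

section DiagonalMinusTail

variable {m : ℕ} {ι : Type}

open scoped Classical in
/-- The coefficients of the diagonal form that dominates the monomial `∏ a, x (j a)` and touches
it at the positive point `w`. -/
noncomputable def tangentCoeff (w : ι → ℝ) (j : Fin m → ι) (i : ι) : ℝ :=
  ((Finset.univ.filter fun a => j a = i).card : ℝ) * ((∏ a, w (j a)) / (m * w i ^ m))

theorem tangentCoeff_nonneg {w : ι → ℝ} (hw : ∀ i, 0 < w i) (j : Fin m → ι) (i : ι) :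
    0 ≤ tangentCoeff w j i :=
  mul_nonneg (Nat.cast_nonneg _) <| div_nonneg (Finset.prod_nonneg fun _ _ => (hw _).le) <|
    mul_nonneg (Nat.cast_nonneg _) (pow_nonneg (hw i).le _)

variable [Fintype ι]

theorem sum_card_fiber_mul [DecidableEq ι] {R : Type*} [CommSemiring R] (j : Fin m → ι)
    (f : ι → R) : ∑ i, ((Finset.univ.filter fun a => j a = i).card : R) * f i = ∑ a, f (j a) := by
  rw [← Finset.sum_fiberwise Finset.univ j]
  refine Finset.sum_congr rfl fun i _ => ?_
  rw [Finset.sum_congr rfl (g := fun _ => f i), Finset.sum_const, nsmul_eq_mul]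
  intro a ha
  rw [(Finset.mem_filter.1 ha).2]

theorem sum_tangentCoeff_mul (w x : ι → ℝ) (j : Fin m → ι) :
    ∑ i, tangentCoeff w j i * x i ^ m
      = ∑ a, (∏ a, w (j a)) / (m * w (j a) ^ m) * x (j a) ^ m := by
  classical
  rw [← sum_card_fiber_mul j fun i => (∏ a, w (j a)) / (m * w i ^ m) * x i ^ m]
  refine Finset.sum_congr rfl fun i _ => ?_
  rw [tangentCoeff, mul_assoc]

theorem sum_tangentCoeff_mul_self (hm0 : 0 < m) {w : ι → ℝ} (hw : ∀ i, 0 < w i)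
    (j : Fin m → ι) : ∑ i, tangentCoeff w j i * w i ^ m = ∏ a, w (j a) := by
  rw [sum_tangentCoeff_mul]
  have : ∀ a, (∏ a, w (j a)) / (m * w (j a) ^ m) * w (j a) ^ m = (∏ a, w (j a)) / m := by
    intro a
    have := (hw (j a)).ne'
    field_simp
  simp only [this, Finset.sum_const, Finset.card_univ, Fintype.card_fin, nsmul_eq_mul]
  field_simp

/-- AM-GM for the ratios `x (j a) / w (j a)`, multiplied by the positive number `(∏ a, w (j a)) /
m`. -/
theorem prod_le_sum_tangentCoeff_mul (hm : Even m) (hm0 : 0 < m) {w : ι → ℝ} (hw : ∀ i, 0 < w i)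
    (j : Fin m → ι) (x : ι → ℝ) : ∏ a, x (j a) ≤ ∑ i, tangentCoeff w j i * x i ^ m := by
  have h := mul_prod_le_sum_pow hm fun a => x (j a) / w (j a)
  have hP : 0 < ∏ a, w (j a) := Finset.prod_pos fun a _ => hw _
  have hm' : (0 : ℝ) < m := by exact_mod_cast hm0
  rw [Finset.prod_div_distrib] at h
  rw [sum_tangentCoeff_mul]
  have e : ∑ a, (∏ a, w (j a)) / (m * w (j a) ^ m) * x (j a) ^ m
      = (∏ a, w (j a)) / m * ∑ a, (x (j a) / w (j a)) ^ m := by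
    rw [Finset.mul_sum]
    refine Finset.sum_congr rfl fun a _ => ?_
    have := (hw (j a)).ne'
    rw [div_pow]
    field_simp
  rw [e]
  calc ∏ a, x (j a) = (∏ a, w (j a)) / m * (m * ((∏ a, x (j a)) / ∏ a, w (j a))) := by
        field_simp
    _ ≤ _ := mul_le_mul_of_nonneg_left h (by positivity)

/-- The diagonals `k` such that `∑ i, k i * x i ^ m` dominates the tail termwise. -/
def splitDiagonals (c : (Fin m → ι) → ℝ) : Set (ι → ℝ) :=
  {k | ∃ b : (Fin m → ι) → ι → ℝ, (∀ j i, 0 ≤ b j i) ∧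
    (∀ (j : Fin m → ι) (x : ι → ℝ), c j * ∏ a, x (j a) ≤ ∑ i, b j i * x i ^ m) ∧
    ∀ i, ∑ j, b j i ≤ k i}

theorem convex_splitDiagonals (c : (Fin m → ι) → ℝ) : Convex ℝ (splitDiagonals c) := by
  rintro k ⟨b, hb, hbx, hbk⟩ k' ⟨b', hb', hbx', hbk'⟩ s t hs ht hst
  refine ⟨fun j i => s * b j i + t * b' j i, fun j i => ?_, fun j x => ?_, fun i => ?_⟩
  · have := hb j i
    have := hb' j i
    positivity
  · have h1 := mul_le_mul_of_nonneg_left (hbx j x) hs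
    have h2 := mul_le_mul_of_nonneg_left (hbx' j x) ht
    simp only [add_mul, mul_assoc, Finset.sum_add_distrib, ← Finset.mul_sum]
    calc c j * ∏ a, x (j a) = (s + t) * (c j * ∏ a, x (j a)) := by rw [hst, one_mul]
      _ ≤ _ := by rw [add_mul]; exact add_le_add h1 h2
  · simp only [Finset.sum_add_distrib, ← Finset.mul_sum, Pi.add_apply, Pi.smul_apply, smul_eq_mul]
    exact add_le_add (mul_le_mul_of_nonneg_left (hbk i) hs)
      (mul_le_mul_of_nonneg_left (hbk' i) ht)

/-- The witnesses `b` are nonnegative and bounded by the diagonal they split, so along a convergent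
sequence of diagonals a subsequence of them converges. -/
theorem isClosed_splitDiagonals (c : (Fin m → ι) → ℝ) : IsClosed (splitDiagonals c) := by
  classical
  refine IsSeqClosed.isClosed fun k k₀ hk hlim => ?_
  choose b hb hbx hbk using hk
  obtain ⟨M, hM⟩ : ∃ M : ι → ℝ, ∀ i n, k n i ≤ M i := by
    choose M hM using fun i => (tendsto_pi_nhds.1 hlim i).bddAbove_range
    exact ⟨M, fun i n => hM i ⟨n, rfl⟩⟩
  have hmem : ∀ n, b n ∈ Set.Icc (0 : (Fin m → ι) → ι → ℝ) (fun _ => M) := fun n =>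
    ⟨fun j i => hb n j i, fun j i => ((Finset.single_le_sum (f := fun j => b n j i)
      (fun j _ => hb n j i) (Finset.mem_univ j)).trans (hbk n i)).trans (hM i n)⟩
  obtain ⟨b₀, -, φ, hφ, hb₀⟩ := isCompact_Icc.tendsto_subseq hmem
  have hc : ∀ j i, Filter.Tendsto (fun n => b (φ n) j i) Filter.atTop (nhds (b₀ j i)) :=
    fun j i => tendsto_pi_nhds.1 (tendsto_pi_nhds.1 hb₀ j) i
  refine ⟨b₀, fun j i => ge_of_tendsto' (hc j i) fun n => hb _ j i, fun j x => ?_, fun i => ?_⟩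
  · exact ge_of_tendsto' (tendsto_finsetSum _ fun i _ => (hc j i).mul_const _)
      fun n => hbx (φ n) j x
  · exact le_of_tendsto_of_tendsto' (tendsto_finsetSum _ fun j _ => hc j i)
      ((tendsto_pi_nhds.1 hlim i).comp hφ.tendsto_atTop) fun n => hbk (φ n) i

theorem sum_tangentCoeff_mem_splitDiagonals (hm : Even m) (hm0 : 0 < m) {c : (Fin m → ι) → ℝ}
    (hc : ∀ j, 0 ≤ c j) {w : ι → ℝ} (hw : ∀ i, 0 < w i) :
    (fun i => ∑ j, c j * tangentCoeff w j i) ∈ splitDiagonals c := by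
  refine ⟨fun j i => c j * tangentCoeff w j i,
    fun j i => mul_nonneg (hc j) (tangentCoeff_nonneg hw j i), fun j x => ?_, fun i => le_rfl⟩
  simp only [mul_assoc, ← Finset.mul_sum]
  exact mul_le_mul_of_nonneg_left (prod_le_sum_tangentCoeff_mul hm hm0 hw j x) (hc j)

/-- The diagonal of a nonnegative diagonal-minus-tail form can be distributed over the terms of
the tail. -/
theorem mem_splitDiagonals (hm : Even m) (hm0 : 0 < m) {c : (Fin m → ι) → ℝ}
    (hc : ∀ j, 0 ≤ c j) {d : ι → ℝ}
    (h : ∀ x : ι → ℝ, ∑ j, c j * ∏ a, x (j a) ≤ ∑ i, d i * x i ^ m) :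
    d ∈ splitDiagonals c := by
  classical
  -- Separate `d` from the closed convex set by a functional with coefficient vector `z`, then test
  -- the hypothesis at a point `w` with `w i ^ m` close to `z i`. The diagonal tangent at `w` lies
  -- in the set and will violate the separation.
  by_contra hd
  obtain ⟨f, u, hfd, hfk⟩ := geometric_hahn_banach_point_closed (convex_splitDiagonals c)
    (isClosed_splitDiagonals c) hd
  set z : ι → ℝ := fun i => f (Pi.single i 1) with hz
  have hf : ∀ k, f k = ∑ i, k i * z i := by
    intro k
    have := LinearMap.pi_apply_eq_sum_univ (f : (ι → ℝ) →ₗ[ℝ] ℝ) k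
    simp only [ContinuousLinearMap.coe_coe, smul_eq_mul] at this
    rw [this]
    refine Finset.sum_congr rfl fun i _ => ?_
    rw [hz]
    congr 2
    ext j
    simp [Pi.single_apply, eq_comm]
  -- The set is upward closed. If `z i < 0`, increasing coordinate `i` by `r` brings the functional
  -- down to exactly `u`, which is excluded.
  have hz0 : ∀ i, 0 ≤ z i := by
    intro i
    by_contra! hi
    have hk₀ := sum_tangentCoeff_mem_splitDiagonals hm hm0 hc (w := fun _ => 1)
      fun _ => one_pos
    set k₀ : ι → ℝ := fun i => ∑ j, c j * tangentCoeff (fun _ => 1) j i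
    set r : ℝ := (f k₀ - u) / (-z i) with hr
    have hr0 : 0 ≤ r := div_nonneg (by linarith [hfk _ hk₀]) (by linarith)
    have hmem : k₀ + r • Pi.single i 1 ∈ splitDiagonals c := by
      obtain ⟨b, hb, hbx, hbk⟩ := hk₀
      refine ⟨b, hb, hbx, fun i' => (hbk i').trans ?_⟩
      have : 0 ≤ (Pi.single i 1 : ι → ℝ) i' := by
        rw [Pi.single_apply]; split_ifs <;> norm_num
      simp only [Pi.add_apply, Pi.smul_apply, smul_eq_mul]
      nlinarith [mul_nonneg hr0 this]
    have h1 := hfk _ hmem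
    rw [map_add, map_smul, smul_eq_mul] at h1
    have h2 : r * f (Pi.single i 1) = -(f k₀ - u) := by
      change r * z i = _
      rw [hr]
      field_simp [hi.ne]
    linarith
  -- Tangency needs `w` strictly positive while `z` may have zeros; `ε` is small enough that the
  -- shift keeps the value at `d` below `u`.
  set ε : ℝ := (u - f d) / (2 * (|∑ i, d i| + 1)) with hε
  have hε0 : 0 < ε := div_pos (by linarith) (by positivity)
  have hεd : ε * ∑ i, d i < u - f d := by
    have : ε * (|∑ i, d i| + 1) = (u - f d) / 2 := by
      rw [hε]; field_simp
    nlinarith [le_abs_self (∑ i, d i), abs_nonneg (∑ i, d i)]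
  set w : ι → ℝ := fun i => (z i + ε) ^ ((m : ℝ)⁻¹) with hw
  have hw0 : ∀ i, 0 < w i := fun i => Real.rpow_pos_of_pos (by linarith [hz0 i]) _
  have hwm : ∀ i, w i ^ m = z i + ε := fun i =>
    Real.rpow_inv_natCast_pow (by linarith [hz0 i]) hm0.ne'
  have h1 := hfk _ (sum_tangentCoeff_mem_splitDiagonals hm hm0 hc hw0)
  have h2 := h w
  have h3 : ∑ j, c j * ∏ a, w (j a) = ∑ i, (∑ j, c j * tangentCoeff w j i) * (z i + ε) := by
    simp only [← sum_tangentCoeff_mul_self hm0 hw0, Finset.mul_sum, Finset.sum_mul, ← hwm]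
    rw [Finset.sum_comm]
    simp only [mul_assoc]
  have h4 : ∑ i, (∑ j, c j * tangentCoeff w j i) * z i
      ≤ ∑ i, (∑ j, c j * tangentCoeff w j i) * (z i + ε) :=
    Finset.sum_le_sum fun i _ => mul_le_mul_of_nonneg_left (by linarith) <|
      Finset.sum_nonneg fun j _ => mul_nonneg (hc j) (tangentCoeff_nonneg hw0 j i)
  rw [hf] at h1 hfd
  rw [hf] at hεd
  simp only [hwm, mul_add, Finset.sum_add_distrib, ← Finset.sum_mul] at h2
  linarith

theorem isSumSq_sum_C_mul_X_pow (hm : Even m) {b : ι → ℝ} (hb : ∀ i, 0 ≤ b i) :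
    IsSumSq (∑ i, C (b i) * X i ^ m : MvPolynomial ι ℝ) :=
  IsSumSq.sum fun i _ => (isSumSq_algebraMap (hb i)).mul (isSumSq_even_pow hm _)

/-- If this coefficient vanished, the variable could grow to `t` with all others equal to 1: the
diagonal side stays at most `∑ b`, while the monomial side reaches at least `c * t > ∑ b`. -/
theorem diagonal_pos_of_monomial_le {b : ι → ℝ} (hb : ∀ i, 0 ≤ b i) {c : ℝ} (hc : 0 < c)
    (j : Fin m → ι) (h : ∀ x : ι → ℝ, c * ∏ a, x (j a) ≤ ∑ i, b i * x i ^ m) (a : Fin m) :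
    0 < b (j a) := by
  classical
  refine (hb _).lt_of_ne' fun h0 => ?_
  set t : ℝ := (∑ i, b i) / c + 1 with ht
  have hB : 0 ≤ ∑ i, b i := Finset.sum_nonneg fun i _ => hb i
  have ht1 : 1 ≤ t := by
    have := div_nonneg hB hc.le
    linarith
  have h1 := h (Function.update 1 (j a) t)
  have h2 : ∑ i, b i * (Function.update 1 (j a) t : ι → ℝ) i ^ m ≤ ∑ i, b i := by
    refine Finset.sum_le_sum fun i _ => ?_
    by_cases hi : i = j a
    · rw [hi, h0, zero_mul]
    · rw [Function.update_of_ne hi]; simp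
  have h3 : t ≤ ∏ a', (Function.update 1 (j a) t : ι → ℝ) (j a') := by
    have hge : ∀ i, 1 ≤ (Function.update 1 (j a) t : ι → ℝ) i := by
      intro i
      by_cases hi : i = j a
      · rw [hi, Function.update_self]; exact ht1
      · rw [Function.update_of_ne hi]; simp
    rw [← Finset.mul_prod_erase _ _ (Finset.mem_univ a), Function.update_self]
    exact le_mul_of_one_le_right (by linarith) (Finset.one_le_prod fun i _ => hge _)
  have h4 : c * t = ∑ i, b i + c := by rw [ht]; field_simp
  nlinarith [mul_le_mul_of_nonneg_left h3 hc.le]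

/-- A nonnegative diagonal-minus-tail form whose tail has a single term is a sum of squares. -/
theorem isSumSq_diagonal_sub_monomial (hm : Even m) (hm0 : 0 < m) {b : ι → ℝ}
    (hb : ∀ i, 0 ≤ b i) {c : ℝ} (hc : 0 ≤ c) (j : Fin m → ι)
    (h : ∀ x : ι → ℝ, c * ∏ a, x (j a) ≤ ∑ i, b i * x i ^ m) :
    IsSumSq (∑ i, C (b i) * X i ^ m - C c * ∏ a, X (j a) : MvPolynomial ι ℝ) := by
  classical
  rcases hc.eq_or_lt with rfl | hc
  · simpa using isSumSq_sum_C_mul_X_pow hm hb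
  have hm' : (0 : ℝ) < m := by exact_mod_cast hm0
  have hbpos := diagonal_pos_of_monomial_le hb hc j h
  set N : ι → ℕ := fun i => (Finset.univ.filter fun a => j a = i).card with hN
  have hNj : ∀ a, N (j a) ≠ 0 := fun a =>
    (Finset.card_pos.2 ⟨a, by simp⟩).ne'
  have hNb : ∀ i, N i ≠ 0 → 0 < b i := by
    intro i hi
    obtain ⟨a, ha⟩ := Finset.card_pos.1 (Nat.pos_of_ne_zero hi)
    rw [← (Finset.mem_filter.1 ha).2]
    exact hbpos a
  set b' : ι → ℝ := fun i => if N i = 0 then 0 else b i with hb'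
  have hb'0 : ∀ i, 0 ≤ b' i ∧ b' i ≤ b i := by
    intro i
    simp only [hb']
    split_ifs
    · exact ⟨le_rfl, hb i⟩
    · exact ⟨hb i, le_rfl⟩
  -- The equality point of AM-GM: on the support of the monomial, `b i * w i ^ m = N i / m`, and
  -- these weights sum to 1.
  set w : ι → ℝ := fun i => if N i = 0 then 1 else (N i / (m * b i)) ^ ((m : ℝ)⁻¹) with hw
  have hw0 : ∀ i, 0 < w i := by
    intro i
    simp only [hw]
    split_ifs with hi
    · exact one_pos
    · have := hNb i hi
      have : (0 : ℝ) < N i := by exact_mod_cast Nat.pos_of_ne_zero hi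
      positivity
  have hbw : ∀ i, b' i * w i ^ m = N i / m := by
    intro i
    simp only [hb', hw]
    split_ifs with hi
    · simp [hi]
    · have := hNb i hi
      rw [Real.rpow_inv_natCast_pow (by positivity) hm0.ne']
      field_simp
  set P : ℝ := ∏ a, w (j a) with hP
  have hP0 : 0 < P := Finset.prod_pos fun a _ => hw0 _
  -- Evaluate at `w` on the support and 0 elsewhere. The slack `1 - c * P` then leaves a nonnegative
  -- diagonal after subtracting `c * P / m` times the rescaled Hurwitz form.
  have hcP : c * P ≤ 1 := by
    have h1 := h fun i => if N i = 0 then 0 else w i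
    simp only [hNj, if_false] at h1
    refine h1.trans (le_of_eq ?_)
    have h2 : ∀ i, b i * (if N i = 0 then 0 else w i) ^ m = (N i : ℝ) * (m : ℝ)⁻¹ := by
      intro i
      rw [← div_eq_mul_inv, ← hbw i]
      simp only [hb']
      split_ifs
      · simp [hm0.ne']
      · rfl
    simp only [h2]
    rw [sum_card_fiber_mul j fun _ => (m : ℝ)⁻¹]
    simp [hm'.ne']
  have h1 := isSumSq_sum_pow_sub_mul_prod hm fun a => (C (w (j a))⁻¹ * X (j a) : MvPolynomial ι ℝ)
  have h2 : IsSumSq (∑ i, C (b i - c * P * b' i) * X i ^ m : MvPolynomial ι ℝ) := by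
    refine isSumSq_sum_C_mul_X_pow hm fun i => ?_
    exact sub_nonneg.2 ((mul_le_of_le_one_left (hb'0 i).1 hcP).trans (hb'0 i).2)
  have h3 := (isSumSq_smul (c := c * P / m) (div_nonneg (mul_pos hc hP0).le hm'.le) h1).add h2
  refine Eq.subst (motive := IsSumSq) ?_ h3
  have e1 : ∑ a, (C (w (j a))⁻¹ * X (j a) : MvPolynomial ι ℝ) ^ m
      = ∑ i, C (m * b' i) * X i ^ m := by
    refine (sum_card_fiber_mul j fun i => (C (w i)⁻¹ * X i : MvPolynomial ι ℝ) ^ m).symm.trans ?_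
    refine Finset.sum_congr rfl fun i _ => ?_
    have : (m * b' i : ℝ) = N i * (w i)⁻¹ ^ m := by
      rw [inv_pow, eq_mul_inv_iff_mul_eq₀ (pow_ne_zero _ (hw0 i).ne'), mul_assoc, hbw i]
      field_simp
    rw [this, mul_pow, ← C_pow, C_mul, mul_assoc, map_natCast C]
  have e2 : ∏ a, (C (w (j a))⁻¹ * X (j a) : MvPolynomial ι ℝ) = C P⁻¹ * ∏ a, X (j a) := by
    rw [Finset.prod_mul_distrib, ← map_prod, Finset.prod_inv_distrib]
  rw [e1, e2, smul_sub, ← map_natCast C, smul_eq_C_mul, smul_eq_C_mul, ← mul_assoc, ← mul_assoc,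
    ← C_mul, ← C_mul]
  have e3 : c * P / m * (m : ℝ) * P⁻¹ = c := by field_simp
  rw [e3, Finset.mul_sum]
  have e4 : ∀ i, (C (b i - c * P * b' i) * X i ^ m : MvPolynomial ι ℝ)
      = C (b i) * X i ^ m - C (c * P / m) * (C (m * b' i) * X i ^ m) := by
    intro i
    rw [← mul_assoc, ← C_mul, ← sub_mul, ← C_sub]
    congr 3
    field_simp
  simp only [e4, Finset.sum_sub_distrib]
  ring

/-- A nonnegative diagonal-minus-tail form is a sum of squares. -/
theorem isSumSq_diagonal_sub_tail (hm : Even m) (hm0 : 0 < m) {c : (Fin m → ι) → ℝ}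
    (hc : ∀ j, 0 ≤ c j) {d : ι → ℝ}
    (h : ∀ x : ι → ℝ, ∑ j, c j * ∏ a, x (j a) ≤ ∑ i, d i * x i ^ m) :
    IsSumSq (∑ i, C (d i) * X i ^ m - ∑ j, C (c j) * ∏ a, X (j a) : MvPolynomial ι ℝ) := by
  obtain ⟨b, hb, hbx, hbd⟩ := mem_splitDiagonals hm hm0 hc h
  have h1 : IsSumSq (∑ j, (∑ i, C (b j i) * X i ^ m - C (c j) * ∏ a, X (j a)) :
      MvPolynomial ι ℝ) :=
    IsSumSq.sum fun j _ => isSumSq_diagonal_sub_monomial hm hm0 (hb j) (hc j) j (hbx j)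
  have h2 := isSumSq_sum_C_mul_X_pow hm (b := fun i => d i - ∑ j, b j i)
    fun i => sub_nonneg.2 (hbd i)
  refine Eq.subst (motive := IsSumSq) ?_ (h1.add h2)
  simp only [C_sub, sub_mul, Finset.sum_sub_distrib, map_sum, Finset.sum_mul]
  rw [Finset.sum_comm]
  ring

end DiagonalMinusTail

/-! ### Gluing nonnegative forms along at most one shared variable -/

section Gluing

variable {V : Type} {m : ℕ}

/-- Points that agree on the shared variables glue to a single point, at which `g` sees only `x` and
`h` only `y`. -/
theorem nonneg_add_of_agree {g h : (V → ℝ) → ℝ} {U W : Set V} (hg : DependsOn g U)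
    (hh : DependsOn h W) (hgh : ∀ x, 0 ≤ g x + h x) {x y : V → ℝ}
    (hxy : ∀ i ∈ U ∩ W, x i = y i) : 0 ≤ g x + h y := by
  classical
  have h1 := hgh fun i => if i ∈ U then x i else y i
  have e1 : g (fun i => if i ∈ U then x i else y i) = g x := hg fun i hi => by simp [hi]
  have e2 : h (fun i => if i ∈ U then x i else y i) = h y := hh fun i hi => by
    by_cases hU : i ∈ U
    · simp [hU, hxy i ⟨hU, hi⟩]
    · simp [hU]
  rwa [e1, e2] at h1

/-- A nonnegative sum of two forms of even degree that share at most the variable `k` splits into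
nonnegative forms by moving a multiple of `x k ^ m`. -/
theorem exists_split_of_shared_variable (hm : Even m) (hm0 : 0 < m) {g h : (V → ℝ) → ℝ}
    {U W : Set V} (hg : DependsOn g U) (hh : DependsOn h W)
    (hg' : ∀ (t : ℝ) (x), g (t • x) = t ^ m * g x) (hh' : ∀ (t : ℝ) (x), h (t • x) = t ^ m * h x)
    (hgh : ∀ x, 0 ≤ g x + h x) {k : V} (hk : U ∩ W ⊆ {k}) :
    ∃ r : ℝ, (∀ x, 0 ≤ g x + r * x k ^ m) ∧ ∀ x, 0 ≤ h x - r * x k ^ m := by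
  have key : ∀ x y : V → ℝ, x k = y k → 0 ≤ g x + h y := fun x y hxy =>
    nonneg_add_of_agree hg hh hgh fun i hi => by rw [hk hi]; exact hxy
  have hg0 : g 0 = 0 := by simpa [hm0.ne'] using hg' 0 0
  have hh0 : h 0 = 0 := by simpa [hm0.ne'] using hh' 0 0
  -- The constant to move is the infimum of `h` on the slice `x k = 1`: gluing bounds it below by
  -- every value of `-g` on that slice. Homogeneity covers `x k ≠ 0`, and comparison with the zero
  -- vector covers `x k = 0`.
  set S : Set ℝ := h '' {y | y k = 1} with hS
  have hbdd : BddBelow S := by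
    refine ⟨-g 1, ?_⟩
    rintro _ ⟨y, hy, rfl⟩
    have := key 1 y hy.symm
    linarith
  have hne : S.Nonempty := ⟨_, 1, rfl, rfl⟩
  have hr : ∀ (x : V → ℝ), x k ≠ 0 → ((x k)⁻¹ • x) k = 1 := fun x hx => by
    simp [inv_mul_cancel₀ hx]
  refine ⟨sInf S, fun x => ?_, fun x => ?_⟩
  · by_cases hx : x k = 0
    · have := key x 0 (by simp [hx])
      rw [hh0] at this
      simpa [hx, hm0.ne'] using this
    · have h1 : -g ((x k)⁻¹ • x) ≤ sInf S := by
        refine le_csInf hne ?_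
        rintro _ ⟨y, hy, rfl⟩
        have := key _ y ((hr x hx).trans hy.symm)
        linarith
      have h2 : g x = x k ^ m * g ((x k)⁻¹ • x) := by
        rw [← hg', smul_smul, mul_inv_cancel₀ hx, one_smul]
      have h3 : 0 ≤ x k ^ m := hm.pow_nonneg _
      rw [h2]
      nlinarith
  · by_cases hx : x k = 0
    · have := key 0 x (by simp [hx])
      rw [hg0] at this
      simpa [hx, hm0.ne'] using this
    · have h1 : sInf S ≤ h ((x k)⁻¹ • x) := csInf_le hbdd ⟨_, hr x hx, rfl⟩
      have h2 : h x = x k ^ m * h ((x k)⁻¹ • x) := by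
        rw [← hh', smul_smul, mul_inv_cancel₀ hx, one_smul]
      have h3 : 0 ≤ x k ^ m := hm.pow_nonneg _
      rw [h2]
      nlinarith

theorem dependsOn_sum {L : Type*} {h : L → (V → ℝ) → ℝ} {Γ : L → Finset V} (S : Finset L)
    [DecidableEq V] (hh : ∀ l, DependsOn (h l) (Γ l : Set V)) :
    DependsOn (fun x => ∑ l ∈ S, h l x) (S.biUnion Γ : Set V) := by
  intro x y hxy
  refine Finset.sum_congr rfl fun l hl => hh l fun i hi => hxy i ?_
  exact Finset.mem_coe.2 (Finset.mem_biUnion.2 ⟨l, hl, hi⟩)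

/-- A nonnegative sum of forms of even degree whose sets of variables satisfy the running
intersection property with separators of at most one element can be rebalanced, by diagonal
forms that add up to zero, so that each summand is nonnegative. -/
theorem exists_rebalancing [Fintype V] [DecidableEq V] {L : Type*} [Fintype L] [LinearOrder L]
    (hm : Even m) (hm0 : 0 < m) (Γ : L → Finset V)
    (hΓ : ∀ p, (((Finset.univ.filter (fun l => l < p)).biUnion Γ) ∩ Γ p).card ≤ 1)
    (S : Finset L) (h : L → (V → ℝ) → ℝ) (hh : ∀ l, DependsOn (h l) (Γ l : Set V))
    (hh' : ∀ l (t : ℝ) (x), h l (t • x) = t ^ m * h l x) (hsum : ∀ x, 0 ≤ ∑ l ∈ S, h l x) :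
    ∃ ρ : L → V → ℝ, (∀ l i, i ∉ Γ l → ρ l i = 0) ∧ (∀ i, ∑ l ∈ S, ρ l i = 0) ∧
      ∀ l ∈ S, ∀ x, 0 ≤ h l x + ∑ i, ρ l i * x i ^ m := by
  induction S using Finset.induction_on_max generalizing h with
  | empty => exact ⟨0, by simp, by simp, by simp⟩
  | insert p S hp ih =>
    have hpS : p ∉ S := fun hmem => (hp p hmem).false
    have hg := dependsOn_sum S hh
    have hg' : ∀ (t : ℝ) (x), ∑ l ∈ S, h l (t • x) = t ^ m * ∑ l ∈ S, h l x := by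
      intro t x
      simp only [hh', Finset.mul_sum]
    have hgh : ∀ x, 0 ≤ ∑ l ∈ S, h l x + h p x := by
      intro x
      have := hsum x
      rwa [Finset.sum_insert hpS, add_comm] at this
    have hcard : (S.biUnion Γ ∩ Γ p).card ≤ 1 := by
      refine (Finset.card_le_card (Finset.inter_subset_inter_right ?_)).trans (hΓ p)
      exact Finset.biUnion_subset_biUnion_of_subset_left _ fun l hl => by simp [hp l hl]
    rcases (S.biUnion Γ ∩ Γ p).eq_empty_or_nonempty with hE | ⟨k, hk⟩
    · have key : ∀ x y, 0 ≤ ∑ l ∈ S, h l x + h p y := by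
        intro x y
        refine nonneg_add_of_agree hg (hh p) hgh fun i hi => ?_
        have : i ∈ S.biUnion Γ ∩ Γ p := by
          rw [Finset.mem_inter]; exact hi
        simp [hE] at this
      have h0 : ∀ l, h l 0 = 0 := fun l => by simpa [hm0.ne'] using hh' l 0 0
      obtain ⟨ρ, hρ, hρs, hρn⟩ := ih h hh hh' fun x => by simpa [h0] using key x 0
      refine ⟨Function.update ρ p 0, fun l i hi => ?_, fun i => ?_, fun l hl x => ?_⟩
      · by_cases hl : l = p
        · subst hl; simp
        · rw [Function.update_of_ne hl]; exact hρ l i hi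
      · rw [Finset.sum_insert hpS, Function.update_self, Pi.zero_apply, zero_add, ← hρs i]
        refine Finset.sum_congr rfl fun l hl => ?_
        rw [Function.update_of_ne (ne_of_mem_of_not_mem hl hpS)]
      · rcases Finset.mem_insert.1 hl with rfl | hl
        · simpa [h0] using key 0 x
        · rw [Function.update_of_ne (ne_of_mem_of_not_mem hl hpS)]
          exact hρn l hl x
    · have hsub : (S.biUnion Γ : Set V) ∩ (Γ p : Set V) ⊆ {k} := by
        intro i hi
        exact Finset.card_le_one.1 hcard i (by rw [Finset.mem_inter]; exact hi) k hk
      obtain ⟨r, hrg, hrh⟩ := exists_split_of_shared_variable hm hm0 hg (hh p) hg' (hh' p) hgh hsub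
      obtain ⟨hkS, hkp⟩ := Finset.mem_inter.1 hk
      obtain ⟨q, hqS, hkq⟩ := Finset.mem_biUnion.1 hkS
      -- The moved term is charged to one earlier block `q` that already contains `k`, so the
      -- modified form still depends only on the variables of `q`.
      obtain ⟨ρ, hρ, hρs, hρn⟩ := ih (fun l x => h l x + if l = q then r * x k ^ m else 0)
        (fun l x y hxy => by
          dsimp only
          rw [hh l hxy]
          split_ifs with hl
          · subst hl
            rw [hxy k hkq]
          · rfl)
        (fun l t x => by
          rw [hh', mul_add]
          split_ifs
          · rw [Pi.smul_apply, smul_eq_mul, mul_pow]; ring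
          · simp)
        (fun x => by
          rw [Finset.sum_add_distrib, Finset.sum_ite_eq' S q, if_pos hqS]
          exact hrg x)
      have hqp : q ≠ p := ne_of_mem_of_not_mem hqS hpS
      refine ⟨fun l i => if l = p then (if i = k then -r else 0) else
        ρ l i + if l = q then (if i = k then r else 0) else 0,
        fun l i hi => ?_, fun i => ?_, fun l hl x => ?_⟩
      · by_cases hl : l = p
        · subst hl
          have : i ≠ k := by rintro rfl; exact hi hkp
          simp [this]
        · simp only [hl, if_false, hρ l i hi, zero_add]
          split_ifs with h1 h2
          · subst h1 h2
            exact absurd hkq hi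
          · rfl
          · rfl
      · rw [Finset.sum_insert hpS]
        have : ∀ l ∈ S, (if l = p then (if i = k then -r else 0) else
            ρ l i + if l = q then (if i = k then r else 0) else 0)
            = ρ l i + if l = q then (if i = k then r else 0) else 0 := fun l hl =>
          if_neg (ne_of_mem_of_not_mem hl hpS)
        rw [Finset.sum_congr rfl this, Finset.sum_add_distrib, hρs, Finset.sum_ite_eq' S q,
          if_pos hqS]
        by_cases hik : i = k <;> simp [hik]
      · by_cases hlp : l = p
        · subst hlp
          have := hrh x
          simpa [ite_mul, sub_eq_add_neg] using this
        · have hlS : l ∈ S := (Finset.mem_insert.1 hl).resolve_left hlp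
          have := hρn l hlS x
          simp only [hlp, if_false, add_mul, Finset.sum_add_distrib]
          by_cases hlq : l = q
          · simp only [hlq, if_true, ite_mul, zero_mul, Finset.sum_ite_eq', Finset.mem_univ] at this ⊢
            linarith
          · simpa [hlq] using this

end Gluing

/-! ### Blocks with one monomial of either sign, or a nonnegative tail -/

section SignedTail

variable {m : ℕ} {ι : Type}

theorem prod_flip_sign [DecidableEq ι] {R : Type*} [CommRing R] (j : Fin m → ι) (k : ι)
    (hk : Odd (Finset.univ.filter fun a => j a = k).card) (y : ι → R) :
    ∏ a, (if j a = k then -y (j a) else y (j a)) = -∏ a, y (j a) := by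
  have : ∀ a, (if j a = k then -y (j a) else y (j a)) = (if j a = k then -1 else 1) * y (j a) := by
    intro a; split_ifs <;> simp
  simp only [this, Finset.prod_mul_distrib, Finset.prod_ite, Finset.prod_const, hk.neg_one_pow]
  simp

variable [Fintype ι]

/-- A nonnegative form with a single off-diagonal term, of either sign, is a sum of squares. -/
theorem isSumSq_diagonal_sub_monomial_of_not_isDiagonal (hm : Even m) (hm0 : 0 < m) {d : ι → ℝ}
    {c : ℝ} {j : Fin m → ι} (hj : ¬ IsDiagonal j)
    (h : ∀ x : ι → ℝ, c * ∏ a, x (j a) ≤ ∑ i, d i * x i ^ m) :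
    IsSumSq (∑ i, C (d i) * X i ^ m - C c * ∏ a, X (j a) : MvPolynomial ι ℝ) := by
  classical
  have hd : ∀ i, 0 ≤ d i := by
    intro i
    have h1 := h (Pi.single i 1)
    obtain ⟨a, ha⟩ : ∃ a, j a ≠ i := by
      by_contra! hcon
      exact hj ⟨i, hcon⟩
    rw [Finset.prod_eq_zero (Finset.mem_univ a) (Pi.single_eq_of_ne ha _), mul_zero,
      Finset.sum_eq_single i] at h1
    · simpa using h1
    · intro i' _ hi'
      rw [Pi.single_eq_of_ne hi', zero_pow hm0.ne', mul_zero]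
    · simp
  rcases le_or_gt 0 c with hc | hc
  · exact isSumSq_diagonal_sub_monomial hm hm0 hd hc j h
  -- For `c < 0`: if a variable has odd exponent, reversing its sign makes the coefficient positive
  -- and fixes the diagonal; otherwise the monomial is itself a square.
  by_cases hodd : ∃ k, Odd (Finset.univ.filter fun a => j a = k).card
  · obtain ⟨k, hk⟩ := hodd
    have h1 := isSumSq_diagonal_sub_monomial hm hm0 hd (c := -c) (by linarith) j fun x => by
      have h2 := h fun i => if i = k then -x i else x i
      rw [prod_flip_sign j k hk] at h2
      have : ∀ i, (if i = k then -x i else x i) ^ m = x i ^ m := by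
        intro i; split_ifs <;> simp [hm.neg_pow]
      simp only [this] at h2
      linarith
    have h2 := isSumSq_map (aeval (R := ℝ) fun i : ι =>
      (if i = k then -X i else X i : MvPolynomial ι ℝ)).toRingHom h1
    refine Eq.subst (motive := IsSumSq) ?_ h2
    have e : ∀ i : ι, (if i = k then -X i else X i : MvPolynomial ι ℝ) ^ m = X i ^ m := by
      intro i; split_ifs <;> simp [hm.neg_pow]
    simp only [AlgHom.toRingHom_eq_coe, RingHom.coe_coe, map_sub, map_sum, map_mul, map_pow,
      map_prod, aeval_X, aeval_C, algebraMap_eq, e, prod_flip_sign j k hk, map_neg]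
    ring
  · push Not at hodd
    have h1 : IsSumSq (∏ a, X (j a) : MvPolynomial ι ℝ) := by
      rw [← Finset.prod_fiberwise Finset.univ j]
      refine IsSumSq.prod fun i _ => ?_
      rw [Finset.prod_congr rfl (g := fun _ => X i), Finset.prod_const]
      · exact isSumSq_even_pow (Nat.not_odd_iff_even.1 (hodd i)) _
      · intro a ha
        rw [(Finset.mem_filter.1 ha).2]
    have h2 := (isSumSq_sum_C_mul_X_pow hm hd).add
      ((isSumSq_algebraMap (R := MvPolynomial ι ℝ) (c := -c) (by linarith)).mul h1)
    refine Eq.subst (motive := IsSumSq) ?_ h2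
    rw [algebraMap_eq, C_neg]
    ring

open scoped Classical in
/-- The off-diagonal part of a tensor. -/
noncomputable def offDiag (B : Tensor m ι) : Tensor m ι := fun j => if IsDiagonal j then 0 else B j

theorem sum_eq_diag_add_offDiag (hm0 : 0 < m) {R : Type*} [CommRing R] [Algebra ℝ R]
    (B : Tensor m ι) (y : ι → R) :
    ∑ j, algebraMap ℝ R (B j) * ∏ a, y (j a)
      = ∑ i, algebraMap ℝ R (B fun _ => i) * y i ^ m
        + ∑ j, algebraMap ℝ R (offDiag B j) * ∏ a, y (j a) := by
  classical
  have h1 : (Finset.univ.filter fun j : Fin m → ι => IsDiagonal j)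
      = Finset.univ.image fun i _ => i := by
    ext j
    rw [Finset.mem_filter, Finset.mem_image]
    exact ⟨fun ⟨_, k, hk⟩ => ⟨k, Finset.mem_univ k, (funext hk).symm⟩,
      fun ⟨k, _, hk⟩ => ⟨Finset.mem_univ j, k, fun a => by rw [← hk]⟩⟩
  have h2 : ∑ i, algebraMap ℝ R (B fun _ => i) * y i ^ m
      = ∑ j with IsDiagonal j, algebraMap ℝ R (B j) * ∏ a, y (j a) := by
    rw [h1, Finset.sum_image]
    · simp
    · intro i _ i' _ hii
      exact congrFun hii ⟨0, hm0⟩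
  rw [h2, Finset.sum_filter, ← Finset.sum_add_distrib]
  refine Finset.sum_congr rfl fun j _ => ?_
  rw [offDiag]
  split_ifs <;> simp

theorem form_eq_diag_add_offDiag (hm0 : 0 < m) (B : Tensor m ι) (x : ι → ℝ) :
    form B x = ∑ i, B (fun _ => i) * x i ^ m + ∑ j, offDiag B j * ∏ a, x (j a) :=
  sum_eq_diag_add_offDiag hm0 B x

theorem poly_eq_diag_add_offDiag (hm0 : 0 < m) (B : Tensor m ι) :
    poly B = ∑ i, C (B fun _ => i) * X i ^ m + ∑ j, C (offDiag B j) * ∏ a, X (j a) :=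
  sum_eq_diag_add_offDiag hm0 B X

/-- If a tensor of even order has one off-diagonal entry up to permutation, or nonnegative
off-diagonal entries, then a nonnegative form made of it and of a diagonal is a sum of squares. -/
theorem isSumSq_diagonal_sub_poly (hm : Even m) (hm0 : 0 < m) (B : Tensor m ι)
    (hB : (∃ j : Fin m → ι, ¬ IsDiagonal j ∧ ∀ i : Fin m → ι, ¬ IsDiagonal i →
        (¬ ∃ σ : Equiv.Perm (Fin m), i = j ∘ σ) → B i = 0) ∨
      ∀ i : Fin m → ι, ¬ IsDiagonal i → 0 ≤ B i)
    {ρ : ι → ℝ} (h : ∀ x : ι → ℝ, form B x ≤ ∑ i, ρ i * x i ^ m) :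
    IsSumSq (-poly B + ∑ i, C (ρ i) * X i ^ m) := by
  have h1 : ∀ x : ι → ℝ, ∑ j, offDiag B j * ∏ a, x (j a)
      ≤ ∑ i, (ρ i - B fun _ => i) * x i ^ m := by
    intro x
    have := h x
    rw [form_eq_diag_add_offDiag hm0] at this
    simp only [sub_mul, Finset.sum_sub_distrib]
    linarith
  have e : -poly B + ∑ i, C (ρ i) * X i ^ m = ∑ i, C (ρ i - B fun _ => i) * X i ^ m
      - ∑ j, C (offDiag B j) * ∏ a, X (j a) := by
    rw [poly_eq_diag_add_offDiag hm0]
    simp only [C_sub, sub_mul, Finset.sum_sub_distrib]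
    ring
  rw [e]
  rcases hB with ⟨j₀, hj₀, hB⟩ | hB
  · have h2 : ∀ {R : Type} [CommRing R] [Algebra ℝ R] (y : ι → R),
        ∑ j, algebraMap ℝ R (offDiag B j) * ∏ a, y (j a)
          = algebraMap ℝ R (∑ j, offDiag B j) * ∏ a, y (j₀ a) := by
      intro R _ _ y
      rw [map_sum, Finset.sum_mul]
      refine Finset.sum_congr rfl fun j _ => ?_
      by_cases hj : IsDiagonal j
      · simp [offDiag, hj]
      by_cases hσ : ∃ σ : Equiv.Perm (Fin m), j = j₀ ∘ σ
      · obtain ⟨σ, rfl⟩ := hσ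
        congr 1
        exact Equiv.prod_comp σ fun a => y (j₀ a)
      · simp [offDiag, hB j hj hσ]
    have h3 : ∀ x : ι → ℝ, (∑ j, offDiag B j) * ∏ a, x (j₀ a)
        ≤ ∑ i, (ρ i - B fun _ => i) * x i ^ m := fun x => by
      have h4 := h2 x
      simp only [Algebra.algebraMap_self, RingHom.id_apply] at h4
      rw [← h4]
      exact h1 x
    have h5 := isSumSq_diagonal_sub_monomial_of_not_isDiagonal hm hm0 hj₀ h3
    rw [← algebraMap_eq] at h5 ⊢
    rwa [h2]
  · refine isSumSq_diagonal_sub_tail hm hm0 (fun j => ?_) h1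
    rw [offDiag]
    split_ifs with hj
    · exact le_rfl
    · exact hB j hj

end SignedTail

/-! ### The largest H-eigenvalue as a maximum on the sphere -/

section Eigenvalue

variable {m : ℕ} {ι : Type} [Fintype ι]

theorem form_smul (A : Tensor m ι) (t : ℝ) (x : ι → ℝ) : form A (t • x) = t ^ m * form A x := by
  simp only [form, Finset.mul_sum, Pi.smul_apply, smul_eq_mul, Finset.prod_mul_distrib,
    Finset.prod_const, Finset.card_univ, Fintype.card_fin]
  exact Finset.sum_congr rfl fun j _ => by ring

theorem continuous_form (A : Tensor m ι) : Continuous (form A) := by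
  unfold form; fun_prop

theorem sum_pow_pos (hm : Even m) {x : ι → ℝ} (hx : x ≠ 0) : 0 < ∑ i, x i ^ m := by
  obtain ⟨i, hi⟩ := Function.ne_iff.1 hx
  exact Finset.sum_pos' (fun i _ => hm.pow_nonneg _) ⟨i, Finset.mem_univ i, hm.pow_pos hi⟩

open scoped Classical in
/-- The contraction of `A` with `x` in all slots but `b`, evaluated at the index `i`. -/
noncomputable def slotContract (A : Tensor m ι) (x : ι → ℝ) (b : Fin m) (i : ι) : ℝ :=
  ∑ j : Fin m → ι with j b = i, A j * ∏ a ∈ Finset.univ.erase b, x (j a)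

theorem contract_eq_slotContract (hm0 : 0 < m) (A : Tensor m ι) (x : ι → ℝ) (i : ι) :
    contract A x i = slotContract A x ⟨0, hm0⟩ i := by
  classical
  unfold contract slotContract
  have h1 : ∀ j : Fin m → ι, (∀ a : Fin m, a.val = 0 → j a = i) ↔ j ⟨0, hm0⟩ = i := fun j =>
    ⟨fun h => h _ rfl, fun h a ha => by
      have : a = ⟨0, hm0⟩ := Fin.ext ha
      rw [this, h]⟩
  have h2 : (Finset.univ.filter fun a : Fin m => a.val ≠ 0) = Finset.univ.erase ⟨0, hm0⟩ := by
    ext a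
    simp [Fin.ext_iff]
  refine Finset.sum_congr (by ext j; simp [h1]) fun j _ => ?_
  rw [h2]

theorem slotContract_eq (A : Tensor m ι) (hA : IsSymmetric A) (x : ι → ℝ) (b b' : Fin m)
    (i : ι) : slotContract A x b i = slotContract A x b' i := by
  classical
  unfold slotContract
  refine Finset.sum_equiv ((Equiv.swap b b').arrowCongr (Equiv.refl ι)) (fun j => ?_)
    fun j _ => ?_
  · simp [Equiv.arrowCongr]
  · have e : ((Equiv.swap b b').arrowCongr (Equiv.refl ι)) j = j ∘ Equiv.swap b b' := by
      ext a; simp [Equiv.arrowCongr]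
    rw [e, hA]
    congr 1
    refine Finset.prod_equiv (Equiv.swap b b') (fun a => ?_) fun a _ => by simp
    simp only [Finset.mem_erase, Finset.mem_univ, and_true, ne_eq]
    rw [not_iff_not]
    constructor
    · rintro rfl; simp
    · intro h
      rw [← Equiv.swap_apply_self b b' a, h, Equiv.swap_apply_right]

theorem sum_mul_contract (hm0 : 0 < m) (A : Tensor m ι) (x : ι → ℝ) :
    ∑ i, x i * contract A x i = form A x := by
  classical
  simp only [contract_eq_slotContract hm0, slotContract, form, Finset.mul_sum]
  rw [← Finset.sum_fiberwise Finset.univ fun j : Fin m → ι => j ⟨0, hm0⟩]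
  refine Finset.sum_congr rfl fun i _ => Finset.sum_congr rfl fun j hj => ?_
  rw [← Finset.mul_prod_erase _ _ (Finset.mem_univ (⟨0, hm0⟩ : Fin m)),
    (Finset.mem_filter.1 hj).2]
  ring

/-- The product rule yields one contraction per slot; symmetry makes all `m` of them equal. -/
theorem hasDerivAt_form_add_single [DecidableEq ι] (hm0 : 0 < m) {A : Tensor m ι}
    (hA : IsSymmetric A) (x : ι → ℝ) (i : ι) :
    HasDerivAt (fun t : ℝ => form A fun k => x k + t * Pi.single (M := fun _ => ℝ) i 1 k)
      (m * contract A x i) 0 := by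
  have h1 : ∀ k, HasDerivAt (fun t : ℝ => x k + t * Pi.single (M := fun _ => ℝ) i 1 k)
      (Pi.single (M := fun _ => ℝ) i 1 k) 0 := fun k => by
    simpa using ((hasDerivAt_id (0 : ℝ)).mul_const (Pi.single (M := fun _ => ℝ) i 1 k)).const_add
      (x k)
  have h2 := HasDerivAt.fun_sum (u := Finset.univ) fun (j : Fin m → ι) _ =>
    (HasDerivAt.fun_finsetProd (u := Finset.univ) fun a _ => h1 (j a)).const_mul (A j)
  refine h2.congr_deriv ?_
  have h3 : ∑ b, slotContract A x b i = m * contract A x i := by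
    rw [contract_eq_slotContract hm0, Finset.sum_congr rfl fun b _ =>
      slotContract_eq A hA x b ⟨0, hm0⟩ i]
    simp
  rw [← h3]
  simp only [slotContract, Finset.sum_filter, Finset.mul_sum]
  rw [Finset.sum_comm]
  refine Finset.sum_congr rfl fun b _ => Finset.sum_congr rfl fun j _ => ?_
  by_cases hb : j b = i
  · subst hb; simp
  · simp [hb]

/-- The form of a symmetric tensor of even order attains its maximum on the unit sphere of the
`m`-norm at an eigenvector. -/
theorem exists_isHEigenvalue_forall_form_le [Nonempty ι] (hm : Even m) (hm0 : 0 < m)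
    {A : Tensor m ι} (hA : IsSymmetric A) :
    ∃ M, IsHEigenvalue A M ∧ (∃ x : ι → ℝ, ∑ i, x i ^ m = 1 ∧ form A x = M) ∧
      ∀ x, form A x ≤ M * ∑ i, x i ^ m := by
  classical
  set K : Set (ι → ℝ) := {x | ∑ i, x i ^ m = 1} with hK
  have hKc : IsCompact K := by
    refine Metric.isCompact_of_isClosed_isBounded ?_ ?_
    · exact isClosed_eq (by fun_prop) continuous_const
    · refine (Metric.isBounded_closedBall (x := (0 : ι → ℝ)) (r := 1)).subset fun x hx => ?_
      rw [mem_closedBall_zero_iff, pi_norm_le_iff_of_nonneg zero_le_one]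
      intro i
      have h1 : x i ^ m ≤ 1 := by
        rw [← show ∑ i, x i ^ m = 1 from hx]
        exact Finset.single_le_sum (f := fun i => x i ^ m) (fun i _ => hm.pow_nonneg _)
          (Finset.mem_univ i)
      rw [← hm.pow_abs] at h1
      exact (pow_le_one_iff_of_nonneg (abs_nonneg _) hm0.ne').1 h1
  have hKn : K.Nonempty := by
    obtain ⟨i⟩ := ‹Nonempty ι›
    refine ⟨Pi.single i 1, ?_⟩
    change ∑ k, (Pi.single i 1 : ι → ℝ) k ^ m = 1
    rw [Finset.sum_eq_single i]
    · simp
    · intro k _ hk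
      rw [Pi.single_eq_of_ne hk, zero_pow hm0.ne']
    · simp
  obtain ⟨x₀, hx₀, hmax⟩ := hKc.exists_isMaxOn hKn (continuous_form A).continuousOn
  have hle : ∀ x, form A x ≤ form A x₀ * ∑ i, x i ^ m := by
    intro x
    rcases eq_or_ne x 0 with rfl | hx
    · have h0 : form A 0 = 0 := by simpa [hm0.ne'] using form_smul A 0 0
      simp [h0, hm0.ne']
    · have hs := sum_pow_pos hm hx
      set s := ∑ i, x i ^ m
      set r : ℝ := s⁻¹ ^ ((m : ℝ)⁻¹) with hr
      have hrm : r ^ m = s⁻¹ := Real.rpow_inv_natCast_pow (inv_nonneg.2 hs.le) hm0.ne'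
      have h1 : r • x ∈ K := by
        change ∑ i, (r • x) i ^ m = 1
        simp only [Pi.smul_apply, smul_eq_mul, mul_pow, ← Finset.mul_sum, hrm]
        exact inv_mul_cancel₀ hs.ne'
      have h2 : form A (r • x) ≤ form A x₀ := hmax h1
      rw [form_smul, hrm, inv_mul_le_iff₀ hs] at h2
      linarith
  have hx₀' : ∑ i, x₀ i ^ m = 1 := hx₀
  refine ⟨form A x₀, ⟨x₀, ?_, fun i => ?_⟩, ⟨x₀, hx₀, rfl⟩, hle⟩
  · rintro rfl
    simp [hm0.ne'] at hx₀'
  · set e : ι → ℝ := Pi.single (M := fun _ => ℝ) i 1 with he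
    have h1 : ∀ k, HasDerivAt (fun t : ℝ => (x₀ k + t * e k) ^ m)
        (m * x₀ k ^ (m - 1) * e k) 0 := fun k => by
      simpa using (((hasDerivAt_id (0 : ℝ)).mul_const (e k)).const_add (x₀ k)).fun_pow m
    have h2 := ((HasDerivAt.fun_sum (u := Finset.univ) fun k _ => h1 k).const_mul
      (form A x₀)).sub (hasDerivAt_form_add_single hm0 hA x₀ i)
    -- Along a coordinate line through `x₀`, `M ∑ x_i^m - A x^m` has a global minimum, with value 0,
    -- at `t = 0`; no Lagrange multiplier rule is needed.
    have h3 := IsLocalMin.hasDerivAt_eq_zero (Filter.Eventually.of_forall fun t => ?_) h2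
    · have h4 : ∑ k, m * x₀ k ^ (m - 1) * e k = m * x₀ i ^ (m - 1) := by
        rw [Finset.sum_eq_single i]
        · simp [he]
        · intro k _ hk
          rw [he, Pi.single_eq_of_ne hk, mul_zero]
        · simp
      rw [h4] at h3
      have hm' : (m : ℝ) ≠ 0 := by exact_mod_cast hm0.ne'
      have : (m : ℝ) * (contract A x₀ i - form A x₀ * x₀ i ^ (m - 1)) = 0 := by linarith
      exact sub_eq_zero.1 ((mul_eq_zero.1 this).resolve_left hm')
    · have h5 := hle fun k => x₀ k + t * e k
      simpa [hx₀'] using h5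

theorem IsHEigenvalue.le_of_forall_form_le (hm : Even m) (hm0 : 0 < m) {A : Tensor m ι}
    {M lam : ℝ} (h : ∀ x, form A x ≤ M * ∑ i, x i ^ m) (hlam : IsHEigenvalue A lam) :
    lam ≤ M := by
  obtain ⟨x, hx, hxe⟩ := hlam
  have h1 : form A x = lam * ∑ i, x i ^ m := by
    rw [← sum_mul_contract hm0, Finset.mul_sum]
    refine Finset.sum_congr rfl fun i _ => ?_
    rw [hxe, mul_left_comm, mul_pow_sub_one hm0.ne']
  exact le_of_mul_le_mul_right (h1 ▸ h x) (sum_pow_pos hm hx)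

end Eigenvalue

/-! ### Gram matrices and the semidefinite program -/

section Gram

variable {n : ℕ}

open MonomialOrder in
/-- Polynomials with nonnegative leading coefficients cannot cancel each other's leading terms. -/
theorem degLex_degree_le_add_of_leadingCoeff_nonneg {f g : MvPolynomial (Fin n) ℝ}
    (hf : 0 ≤ degLex.leadingCoeff f) (hg : 0 ≤ degLex.leadingCoeff g) :
    degLex.toSyn (degLex.degree f) ≤ degLex.toSyn (degLex.degree (f + g)) ∧
      degLex.toSyn (degLex.degree g) ≤ degLex.toSyn (degLex.degree (f + g)) ∧
      0 ≤ degLex.leadingCoeff (f + g) := by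
  rcases lt_trichotomy (degLex.toSyn (degLex.degree f)) (degLex.toSyn (degLex.degree g)) with
    h | h | h
  · rw [degree_add_eq_right_of_lt h, add_comm, leadingCoeff_add_of_lt h]
    exact ⟨h.le, le_rfl, hg⟩
  · rcases eq_or_ne f 0 with rfl | hf0
    · rw [zero_add]; exact ⟨h.le, le_rfl, hg⟩
    rcases eq_or_ne g 0 with rfl | hg0
    · rw [add_zero]; exact ⟨le_rfl, h.ge, hf⟩
    have hd := degLex.toSyn.injective h
    have hf1 := hf.lt_of_ne' (leadingCoeff_ne_zero_iff.2 hf0)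
    have hg1 := hg.lt_of_ne' (leadingCoeff_ne_zero_iff.2 hg0)
    have hc : 0 < (f + g).coeff (degLex.degree f) := by
      rw [coeff_add]
      nth_rewrite 2 [hd]
      exact add_pos hf1 hg1
    have hle := degLex.le_degree (mem_support_iff.2 hc.ne')
    have hge : degLex.toSyn (degLex.degree (f + g)) ≤ degLex.toSyn (degLex.degree f) := by
      refine degree_add_le.trans ?_
      rw [h, max_self]
    refine ⟨hle, h ▸ hle, ?_⟩
    rw [leadingCoeff, degLex.toSyn.injective (le_antisymm hge hle)]
    exact hc.le
  · rw [degree_add_of_lt h, leadingCoeff_add_of_lt h]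
    exact ⟨le_rfl, h.le, hf⟩

open MonomialOrder in
theorem leadingCoeff_mul_self_nonneg (a : MvPolynomial (Fin n) ℝ) :
    0 ≤ degLex.leadingCoeff (a * a) := by
  rw [leadingCoeff_mul]; exact mul_self_nonneg _

theorem leadingCoeff_nonneg_of_isSumSq {p : MvPolynomial (Fin n) ℝ} (hp : IsSumSq p) :
    0 ≤ MonomialOrder.degLex.leadingCoeff p := by
  induction hp with
  | zero => simp
  | sq_add a _ ih =>
    exact (degLex_degree_le_add_of_leadingCoeff_nonneg (leadingCoeff_mul_self_nonneg a) ih).2.2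

theorem mem_exponents_of_mem_support {p : MvPolynomial (Fin n) ℝ} {d : ℕ}
    (hp : p.totalDegree ≤ d) {γ : Fin n →₀ ℕ} (hγ : γ ∈ p.support) : γ ∈ exponents n d := by
  rw [mem_exponents, ← Finsupp.sum_fintype γ (fun _ e => e) fun _ => rfl]
  exact (le_totalDegree hγ).trans hp

theorem sum_exponents_monomial {p : MvPolynomial (Fin n) ℝ} {d : ℕ} (hp : p.totalDegree ≤ d) :
    ∑ α : exponents n d, monomial (α : Fin n →₀ ℕ) (coeff α.1 p) = p := by
  rw [Finset.sum_coe_sort (exponents n d) fun α => monomial α (coeff α p)]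
  conv_rhs => rw [p.as_sum]
  refine (Finset.sum_subset (fun γ hγ => mem_exponents_of_mem_support hp hγ) fun γ _ hγ => ?_).symm
  rw [notMem_support_iff.1 hγ, monomial_zero]

/-- The polynomial `∑ α β, Q α β x^(α+β)` with Gram matrix `Q`. -/
noncomputable def gramPoly {d : ℕ} (Q : Matrix (exponents n d) (exponents n d) ℝ) :
    MvPolynomial (Fin n) ℝ :=
  ∑ α : exponents n d, ∑ β : exponents n d, monomial (α.1 + β.1) (Q α β)

/-- A sum of squares of degree at most `m` has a positive semidefinite Gram matrix indexed by the
monomials of degree at most `m / 2`. -/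
theorem exists_gram_of_isSumSq {m : ℕ} {p : MvPolynomial (Fin n) ℝ} (hp : IsSumSq p)
    (hd : p.totalDegree ≤ m) :
    ∃ Q : Matrix (exponents n (m / 2)) (exponents n (m / 2)) ℝ, Q.PosSemidef ∧
      p = gramPoly Q := by
  induction hp with
  | zero => exact ⟨0, Matrix.PosSemidef.zero, by simp [gramPoly]⟩
  | sq_add a hs ih =>
    obtain ⟨h1, h2, -⟩ := degLex_degree_le_add_of_leadingCoeff_nonneg
      (leadingCoeff_mul_self_nonneg a) (leadingCoeff_nonneg_of_isSumSq hs)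
    obtain ⟨Q, hQ, hsQ⟩ := ih ((degLex_totalDegree_monotone h2).trans hd)
    -- `IsSumSq` puts no bound on the summands; the absence of cancellation gives `2 * deg a ≤ m`.
    have ha : a.totalDegree ≤ m / 2 := by
      rcases eq_or_ne a 0 with rfl | ha0
      · simp
      have := (degLex_totalDegree_monotone h1).trans hd
      rw [totalDegree_mul_of_isDomain ha0 ha0] at this
      omega
    refine ⟨Matrix.vecMulVec (fun α => coeff α.1 a) (fun α => coeff α.1 a) + Q,
      Matrix.PosSemidef.add ?_ hQ, ?_⟩
    · simpa using Matrix.posSemidef_vecMulVec_self_star fun α : exponents n (m / 2) => coeff α.1 a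
    · have haa : a * a = ∑ α : exponents n (m / 2), ∑ β : exponents n (m / 2),
          monomial (α.1 + β.1) (coeff α.1 a * coeff β.1 a) := by
        conv_lhs => rw [← sum_exponents_monomial ha, Finset.sum_mul_sum]
        simp only [monomial_mul]
      rw [haa, hsQ]
      simp only [gramPoly, Matrix.add_apply, Matrix.vecMulVec_apply, map_add, Finset.sum_add_distrib]

theorem eval_gram_nonneg {d : ℕ} {Q : Matrix (exponents n d) (exponents n d) ℝ}
    (hQ : Q.PosSemidef) (x : Fin n → ℝ) :
    0 ≤ eval x (gramPoly Q) := by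
  have h := hQ.dotProduct_mulVec_nonneg fun α => eval x (monomial (α : Fin n →₀ ℕ) 1)
  refine h.trans_eq ?_
  simp only [gramPoly, dotProduct, Matrix.mulVec, map_sum, Finset.mul_sum, star_trivial]
  refine Finset.sum_congr rfl fun α _ => Finset.sum_congr rfl fun β _ => ?_
  have : monomial (α.1 + β.1) (Q α β)
      = C (Q α β) * (monomial (α : Fin n →₀ ℕ) 1 * monomial (β : Fin n →₀ ℕ) 1) := by
    rw [monomial_mul, C_mul_monomial]; simp
  rw [this, map_mul, map_mul, eval_C]
  ring

variable {m : ℕ}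

/-- The finitely many coefficient equations amount to a polynomial identity, since on both sides all
coefficients beyond degree `m` vanish, on the Gram side because `2 * (m / 2) ≤ m`. -/
theorem maxHEigSDP_feasible_iff (A : Tensor m (Fin n)) {t μ : ℝ}
    (hdeg : (C t - poly A + C μ * (∑ i, X i ^ m - 1)).totalDegree ≤ m)
    (Q : Matrix (exponents n (m / 2)) (exponents n (m / 2)) ℝ) :
    (maxHEigSDP A).Feasible ![t, μ] Q ↔ Q.PosSemidef ∧
      C t - poly A + C μ * (∑ i, X i ^ m - 1)
        = gramPoly Q := by
  refine and_congr_right fun _ => ?_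
  have hp : ∀ γ : Fin n →₀ ℕ, coeff γ (C t - poly A + C μ * (∑ i, X i ^ m - 1))
      = t * coeff γ (1 : MvPolynomial (Fin n) ℝ) - coeff γ (poly A)
        + μ * coeff γ (∑ i, X i ^ m - 1 : MvPolynomial (Fin n) ℝ) := by
    intro γ
    rw [coeff_add, coeff_sub, coeff_C_mul, ← mul_one (C t), coeff_C_mul]
  have hq : ∀ γ : Fin n →₀ ℕ,
      coeff γ (gramPoly Q)
        = ∑ α : exponents n (m / 2), ∑ β : exponents n (m / 2),
          (if (α : Fin n →₀ ℕ) + β = γ then 1 else 0) * Q α β := by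
    intro γ
    simp only [gramPoly, coeff_sum, coeff_monomial, ite_mul, one_mul, zero_mul]
  have hk : ∀ γ : exponents n m,
      ((∑ r, ∑ c, (maxHEigSDP A).mat γ r c * Q r c)
          + ∑ v, (maxHEigSDP A).lin γ v * (![t, μ] : Fin 2 → ℝ) v = (maxHEigSDP A).rhs γ) ↔
        coeff γ.1 (C t - poly A + C μ * (∑ i, X i ^ m - 1)) = coeff γ.1
          (gramPoly Q) := by
    intro γ
    rw [hp, hq, Fin.sum_univ_two]
    simp only [maxHEigSDP, Matrix.of_apply, Matrix.cons_val_zero, Matrix.cons_val_one]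
    constructor <;> intro h <;> linarith
  constructor
  · intro h
    ext γ
    by_cases hγ : γ ∈ exponents n m
    · exact (hk ⟨γ, hγ⟩).1 (h ⟨γ, hγ⟩)
    · rw [hq, notMem_support_iff.1 fun hmem => hγ (mem_exponents_of_mem_support hdeg hmem)]
      refine (Finset.sum_eq_zero fun α _ => Finset.sum_eq_zero fun β _ => ?_).symm
      rw [if_neg, zero_mul]
      rintro rfl
      refine hγ (mem_exponents.2 ?_)
      have h1 := mem_exponents.1 α.2
      have h2 := mem_exponents.1 β.2
      simp only [Finsupp.add_apply, Finset.sum_add_distrib]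
      omega
  · intro h γ
    rw [hk, h]

end Gram

/-! ### Evaluation and degree bounds -/

section Degree

variable {m : ℕ} {ι : Type}

theorem eval_nonneg_of_isSumSq {p : MvPolynomial ι ℝ} (hp : IsSumSq p) (x : ι → ℝ) :
    0 ≤ eval x p :=
  (isSumSq_map (eval x) hp).nonneg

variable [Fintype ι]

theorem eval_poly (A : Tensor m ι) (x : ι → ℝ) : eval x (poly A) = form A x := by
  simp [poly, form, map_sum, map_prod]

theorem totalDegree_poly_le (A : Tensor m ι) : (poly A).totalDegree ≤ m := by
  refine totalDegree_finsetSum_le fun j _ => (totalDegree_mul _ _).trans ?_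
  rw [totalDegree_C, zero_add]
  refine (totalDegree_finsetProd _ _).trans ?_
  simp

theorem totalDegree_sum_C_mul_X_pow_le (ρ : ι → ℝ) :
    (∑ i, C (ρ i) * X i ^ m : MvPolynomial ι ℝ).totalDegree ≤ m := by
  refine totalDegree_finsetSum_le fun j _ => (totalDegree_mul _ _).trans ?_
  rw [totalDegree_C, zero_add, totalDegree_X_pow]

theorem totalDegree_lagrangian_le (A : Tensor m ι) (t μ : ℝ) :
    (C t - poly A + C μ * (∑ i, X i ^ m - 1)).totalDegree ≤ m := by
  refine (totalDegree_add _ _).trans (max_le ((totalDegree_sub _ _).trans (max_le ?_ ?_)) ?_)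
  · simp
  · exact totalDegree_poly_le A
  · refine (totalDegree_mul _ _).trans ?_
    rw [totalDegree_C, zero_add]
    refine (totalDegree_sub _ _).trans (max_le ?_ (by simp))
    simpa using totalDegree_sum_C_mul_X_pow_le (m := m) (fun _ : ι => (1 : ℝ))

end Degree

/-! ### Certificates assembled from the blocks of a W-tensor -/

section Decomposition

variable {m n : ℕ}

theorem IsWDecomposition.card_inter_le {A : Tensor m (Fin n)} {s : ℕ}
    {Γ : Fin s → Finset (Fin n)} {B : (l : Fin s) → Tensor m (Γ l)}
    (hD : IsWDecomposition A Γ B) (p : Fin s) :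
    (((Finset.univ.filter (fun l => l < p)).biUnion Γ) ∩ Γ p).card ≤ 1 := by
  by_cases hp : 0 < p.val
  · rcases hD.inter with rfl | h
    · omega
    · exact h p hp
  · have : (Finset.univ.filter fun l => l < p) = ∅ := by
      ext l
      simp only [Finset.mem_filter, Finset.mem_univ, true_and, Finset.notMem_empty, iff_false,
        Fin.lt_def]
      omega
    simp [this]

theorem sum_coe_eq_sum_of_support {Γ : Finset (Fin n)} {ρ : Fin n → ℝ}
    (hρ : ∀ i, i ∉ Γ → ρ i = 0) (x : Fin n → ℝ) :
    ∑ i : Γ, ρ i * x i ^ m = ∑ i, ρ i * x i ^ m := by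
  rw [Finset.sum_coe_sort Γ fun i => ρ i * x i ^ m]
  exact Finset.sum_subset (Finset.subset_univ _) fun i _ hi => by rw [hρ i hi, zero_mul]

/-- A diagonal that dominates the form of a W-tensor can be distributed over the subtensors. -/
theorem IsWDecomposition.exists_diagonals (hm : Even m) (hm0 : 0 < m) {A : Tensor m (Fin n)}
    {s : ℕ} {Γ : Fin s → Finset (Fin n)} {B : (l : Fin s) → Tensor m (Γ l)}
    (hD : IsWDecomposition A Γ B) {M : ℝ} (hM : ∀ x, form A x ≤ M * ∑ i, x i ^ m) :
    ∃ ρ : Fin s → Fin n → ℝ,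
      (∀ l, -poly (B l) + ∑ i : Γ l, C (ρ l i) * X i ^ m ∈ SOS (Γ l) m) ∧
      ∀ i, ∑ l : Fin s with i ∈ Γ l, ρ l i = M := by
  -- Each `M * x i ^ m` is first charged to one block `sel i` containing `i`; rebalancing then
  -- corrects this arbitrary choice without changing the total.
  choose sel hsel using hD.cover
  obtain ⟨ρ, hρ, hρs, hρn⟩ := exists_rebalancing hm hm0 Γ hD.card_inter_le Finset.univ
    (fun l x => ∑ i, (if sel i = l then M else 0) * x i ^ m - form (B l) fun i => x i)
    (fun l x y hxy => by
      have h1 : (fun i : Γ l => x i) = fun i : Γ l => y i := funext fun i => hxy i i.2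
      dsimp only
      rw [h1]
      congr 1
      refine Finset.sum_congr rfl fun i _ => ?_
      split_ifs with hi
      · rw [hxy i (hi ▸ hsel i)]
      · simp)
    (fun l t x => by
      rw [show (fun i : Γ l => (t • x) i) = t • fun i : Γ l => x i from rfl, form_smul,
        mul_sub, Finset.mul_sum]
      congr 1
      refine Finset.sum_congr rfl fun i _ => ?_
      rw [Pi.smul_apply, smul_eq_mul, mul_pow]
      ring)
    (fun x => by
      rw [Finset.sum_sub_distrib, ← hD.form_eq, Finset.sum_comm]
      simp only [ite_mul, zero_mul, Finset.sum_ite_eq, Finset.mem_univ, if_true, ← Finset.mul_sum]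
      exact sub_nonneg.2 (hM x))
  have hzero : ∀ l i, i ∉ Γ l → (ρ l i + if sel i = l then M else 0) = 0 := by
    intro l i hi
    rw [hρ l i hi, if_neg, add_zero]
    rintro rfl
    exact hi (hsel i)
  refine ⟨fun l i => ρ l i + if sel i = l then M else 0, fun l => ⟨?_, ?_⟩, fun i => ?_⟩
  · refine (totalDegree_add _ _).trans (max_le ?_ (totalDegree_sum_C_mul_X_pow_le _))
    rw [totalDegree_neg]
    exact totalDegree_poly_le _
  · refine isSumSq_diagonal_sub_poly hm hm0 (B l) (hD.sign l) fun y => ?_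
    set x : Fin n → ℝ := fun i => if h : i ∈ Γ l then y ⟨i, h⟩ else 0 with hx
    have hxy : ∀ i : Γ l, y i = x i := fun i => by simp [hx]
    have h1 := hρn l (Finset.mem_univ l) x
    have h2 := sum_coe_eq_sum_of_support (m := m) (hzero l) x
    simp only [add_mul, Finset.sum_add_distrib] at h2 ⊢
    rw [show y = fun i : Γ l => x i from funext hxy]
    linarith
  · rw [Finset.sum_filter_of_ne, Finset.sum_add_distrib, hρs]
    · simp
    · intro l _ hl
      by_contra hi
      exact hl (hzero l i hi)

theorem IsWDecomposition.form_le_of_diagonals (hm : Even m) {A : Tensor m (Fin n)}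
    {s : ℕ} {Γ : Fin s → Finset (Fin n)} {B : (l : Fin s) → Tensor m (Γ l)}
    (hD : IsWDecomposition A Γ B) {t : ℝ} {ρ : Fin s → Fin n → ℝ}
    (hρ : ∀ l, -poly (B l) + ∑ i : Γ l, C (ρ l i) * X i ^ m ∈ SOS (Γ l) m)
    (hρt : ∀ i, ∑ l : Fin s with i ∈ Γ l, ρ l i ≤ t) (x : Fin n → ℝ) :
    form A x ≤ t * ∑ i, x i ^ m := by
  have h1 : ∀ l, form (B l) (fun i => x i) ≤ ∑ i, if i ∈ Γ l then ρ l i * x i ^ m else 0 := by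
    intro l
    have h := eval_nonneg_of_isSumSq (hρ l).2 fun i => x i
    simp only [map_add, map_neg, map_sum, map_mul, map_pow, eval_X, eval_C, eval_poly] at h
    rw [← Finset.sum_filter, Finset.filter_mem_eq_inter, Finset.univ_inter,
      ← Finset.sum_coe_sort (Γ l) fun i => ρ l i * x i ^ m]
    linarith
  rw [hD.form_eq, Finset.mul_sum]
  refine (Finset.sum_le_sum fun l _ => h1 l).trans ?_
  rw [Finset.sum_comm]
  refine Finset.sum_le_sum fun i _ => ?_
  rw [← Finset.sum_filter, ← Finset.sum_mul]
  exact mul_le_mul_of_nonneg_right (hρt i) (hm.pow_nonneg _)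

/-- With `μ = M` the constants cancel and `M ∑ x_i^m - A x^m` is the sum of the block certificates.
The identity is checked at real points because the decomposition is given as an equality of
functions. -/
theorem isSumSq_lagrangian_of_isWTensor (hm : Even m) (hm0 : 0 < m) {A : Tensor m (Fin n)}
    (hW : IsWTensor A) {M : ℝ} (hM : ∀ x, form A x ≤ M * ∑ i, x i ^ m) :
    IsSumSq (C M - poly A + C M * (∑ i, X i ^ m - 1)) := by
  obtain ⟨s, Γ, B, hD⟩ := hW
  obtain ⟨ρ, hρ, hρM⟩ := hD.exists_diagonals hm hm0 hM
  have h : IsSumSq (∑ l, rename (Subtype.val : Γ l → Fin n)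
      (-poly (B l) + ∑ i : Γ l, C (ρ l i) * X i ^ m)) :=
    IsSumSq.sum fun l _ => isSumSq_map (rename (Subtype.val : Γ l → Fin n)).toRingHom (hρ l).2
  refine Eq.subst (motive := IsSumSq) (MvPolynomial.funext fun x => ?_) h
  have h1 : ∑ l, ∑ i : Γ l, ρ l i * x i ^ m = M * ∑ i, x i ^ m := by
    have : ∀ l, ∑ i : Γ l, ρ l i * x i ^ m = ∑ i, if i ∈ Γ l then ρ l i * x i ^ m else 0 := by
      intro l
      rw [← Finset.sum_filter, Finset.filter_mem_eq_inter, Finset.univ_inter,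
        ← Finset.sum_coe_sort (Γ l) fun i => ρ l i * x i ^ m]
    simp only [this]
    rw [Finset.sum_comm, Finset.mul_sum]
    refine Finset.sum_congr rfl fun i _ => ?_
    rw [← Finset.sum_filter, ← Finset.sum_mul, hρM]
  simp only [map_sum, eval_rename, map_add, map_neg, map_sub, map_mul, map_pow, eval_X, eval_C,
    eval_poly, map_one, Function.comp_apply, Finset.sum_add_distrib, Finset.sum_neg_distrib, h1,
    hD.form_eq x]
  rw [show ∑ l, form (B l) (x ∘ Subtype.val) = ∑ l, form (B l) fun i => x i from rfl]
  ring

end Decomposition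

end WTensor

/-! ### The theorem -/

open WTensor

theorem theorem3p2 (m n : ℕ) (hm : Even m) (hm0 : 0 < m) (hn : 0 < n)
    (A : Tensor m (Fin n)) (hsymm : IsSymmetric A) (hW : IsWTensor A) :
    IsGreatest {lam : ℝ | IsHEigenvalue A lam} (lambdaMax A) ∧
    IsLeast {t : ℝ | ∃ μ : ℝ,
      C t - poly A + C μ * (∑ i, X i ^ m - 1) ∈ SOS (Fin n) m} (lambdaMax A) ∧
    (∀ (s : ℕ) (Γ : Fin s → Finset (Fin n)) (B : (l : Fin s) → Tensor m (Γ l)),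
      IsWDecomposition A Γ B →
      IsLeast {t : ℝ | ∃ ρ : Fin s → Fin n → ℝ,
        (∀ l, -poly (B l) + ∑ i : Γ l, C (ρ l i) * X i ^ m ∈ SOS (Γ l) m) ∧
        ∀ i, ∑ l : Fin s with i ∈ Γ l, ρ l i ≤ t} (lambdaMax A)) ∧
    (maxHEigSDP A).IsOptimalValue (lambdaMax A) := by
  have : Nonempty (Fin n) := ⟨⟨0, hn⟩⟩
  obtain ⟨M, hMe, ⟨x₀, hx₀, hx₀M⟩, hM⟩ := exists_isHEigenvalue_forall_form_le hm hm0 hsymm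
  have hgreatest : IsGreatest {lam : ℝ | IsHEigenvalue A lam} M :=
    ⟨hMe, fun lam hlam => hlam.le_of_forall_form_le hm hm0 hM⟩
  have hMmax : lambdaMax A = M := hgreatest.csSup_eq
  -- At the unit maximizer `x₀` the multiplier term vanishes, leaving `t - M`.
  have hlower : ∀ t μ : ℝ, (∀ x, 0 ≤ eval x (C t - poly A + C μ * (∑ i, X i ^ m - 1))) → M ≤ t := by
    intro t μ h
    have h1 := h x₀
    simp only [map_add, map_sub, map_sum, map_mul, map_pow, eval_X, eval_C, eval_poly, map_one,
      hx₀, hx₀M] at h1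
    linarith
  have hsos := isSumSq_lagrangian_of_isWTensor hm hm0 hW hM
  rw [hMmax]
  refine ⟨hgreatest, ⟨⟨M, totalDegree_lagrangian_le A M M, hsos⟩, ?_⟩,
    fun s Γ B hD => ⟨?_, ?_⟩, ?_, ?_⟩
  · rintro t ⟨μ, -, ht⟩
    exact hlower t μ (eval_nonneg_of_isSumSq ht)
  · obtain ⟨ρ, hρ, hρM⟩ := hD.exists_diagonals hm hm0 hM
    exact ⟨ρ, hρ, fun i => (hρM i).le⟩
  · rintro t ⟨ρ, hρ, hρt⟩
    have := hD.form_le_of_diagonals hm hρ hρt x₀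
    rwa [hx₀, hx₀M, mul_one] at this
  · obtain ⟨Q, hQ, hpQ⟩ := exists_gram_of_isSumSq hsos (totalDegree_lagrangian_le A M M)
    refine ⟨![M, M], Q, (maxHEigSDP_feasible_iff A (totalDegree_lagrangian_le A M M) Q).2 ⟨hQ, hpQ⟩,
      ?_⟩
    simp [maxHEigSDP]
  · rintro u ⟨y, Q, hf, rfl⟩
    have hy : y = ![y 0, y 1] := by
      ext v; fin_cases v <;> rfl
    rw [hy, maxHEigSDP_feasible_iff A (totalDegree_lagrangian_le A _ _) Q] at hf
    have h := hlower (y 0) (y 1) fun x => by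
      rw [hf.2]
      exact eval_gram_nonneg hf.1 x
    simpa [maxHEigSDP] using h
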